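/- Let $N$ be a finite set of individuals. A profile over $N$ is a map $\varphi:N\times N\to\{0,1\}$; $a$ qualifies $a'$ if $\varphi(a,a')=1$. The consensus-start-respecting rule $f^{\mathrm{CSR}}$ assigns to $\varphi$ and $T\subseteq N$ a subset of $T$ as follows: let $K_0=\{a\in T:\varphi(a',a)=1\text{ for all }a'\in T\}$ and, for $i\ge 1$, $K_i=K_{i-1}\cup\{a\in T:\varphi(a',a)=1\text{ for some }a'\in K_{i-1}\}$; then $f^{\mathrm{CSR}}(\varphi,T)=K_i$ for any $i\geq 1$ with $K_i=K_{i-1}$. Group Control by Adding Individuals (GCAI) for $f^{\mathrm{CSR}}$ is the following decision problem: given $(N,\varphi,S,T,k)$, where $N$ is a finite set, $\varphi$ is a profile over $N$, $S\subseteq T\subseteq N$ are nonempty and $k$ is an integer, decide whether there is a set $U\subseteq N\setminus T$ with $|U|\le k$ and $S\subseteq f^{\mathrm{CSR}}(\varphi,T\cup U)$. The members of $S$ are the distinguished individuals; let $\ell=|S|$. Theorem. GCAI for $f^{\mathrm{CSR}}$ is fixed-parameter tractable with respect to the number $\ell$ of distinguished individuals, that is, there are an algorithm and a computable function $g$ such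 that the algorithm decides every instance of encoding length $m$ in time $g(\ell)\cdot m^{O(1)}$. More precisely, it can be solved in $O^*(2^{\ell})$ time, that is, in time $2^{\ell}\cdot m^{O(1)}$. (Algorithms are random access machine programs, and the time of an instruction is measured by the bit lengths of the numbers it handles.) -/

import Mathlib

namespace GroupControl

/-! ### Social aggregation rules -/

/-- A profile over `N`: `φ a b = true` means that `a` qualifies `b`. -/
abbrev Profile (N : Type) := N → N → Bool

/-- A social aggregation rule selects, for every profile `φ` over a set `N` and every `T ⊆ N`,
a subset of `T`: the individuals of `T` that are socially qualified at `φ`. -/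
structure AggregationRule where
  select : (N : Type) → Profile N → Set N → Set N
  select_subset : ∀ (N : Type) (φ : Profile N) (T : Set N), select N φ T ⊆ T

/-- The sets `K₀, K₁, …` of the consensus-start-respecting procedure on `T`. -/
def csrStage {N : Type} (φ : Profile N) (T : Set N) : ℕ → Set N
  | 0 => {a | a ∈ T ∧ ∀ b ∈ T, φ b a = true}
  | m + 1 => csrStage φ T m ∪ {a | a ∈ T ∧ ∃ b ∈ csrStage φ T m, φ b a = true}

theorem csrStage_subset {N : Type} (φ : Profile N) (T : Set N) (m : ℕ) :
    csrStage φ T m ⊆ T := by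
  induction m with
  | zero => exact fun _ h => h.1
  | succ m ih => exact Set.union_subset ih fun _ h => h.1

/-- The consensus-start-respecting rule. The stages increase, so their union is the stage at which
the procedure becomes stationary (see `csr_select_eq` and `exists_csrStage_stationary`). -/
def csr : AggregationRule where
  select _ φ T := ⋃ m, csrStage φ T m
  select_subset _ φ T := Set.iUnion_subset (csrStage_subset φ T)

theorem csrStage_mono {N : Type} (φ : Profile N) (T : Set N) : Monotone (csrStage φ T) :=
  monotone_nat_of_le_succ fun _ => Set.subset_union_left

/-- The rule returns every stage that equals its predecessor. -/
theorem csr_select_eq {N : Type} (φ : Profile N) (T : Set N) (m : ℕ)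
    (h : csrStage φ T (m + 1) = csrStage φ T m) :
    csr.select N φ T = csrStage φ T (m + 1) := by
  have key : ∀ j, csrStage φ T (m + j) = csrStage φ T m := by
    intro j
    induction j with
    | zero => rfl
    | succ j ih =>
      have e : csrStage φ T (m + (j + 1)) =
          csrStage φ T (m + j) ∪ {a | a ∈ T ∧ ∃ b ∈ csrStage φ T (m + j), φ b a = true} := rfl
      rw [e, ih]
      exact h
  refine Set.Subset.antisymm (Set.iUnion_subset fun j => ?_)
    (Set.subset_iUnion (csrStage φ T) (m + 1))
  rw [h, ← key j]
  exact csrStage_mono φ T (Nat.le_add_left j m)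

/-- Over a finite set of individuals the procedure becomes stationary. -/
theorem exists_csrStage_stationary {N : Type} [Finite N] (φ : Profile N) (T : Set N) :
    ∃ m, csrStage φ T (m + 1) = csrStage φ T m := by
  obtain ⟨n, hn⟩ := WellFoundedGT.monotone_chain_condition
    (⟨csrStage φ T, csrStage_mono φ T⟩ : ℕ →o Set N)
  exact ⟨n, (hn (n + 1) (Nat.le_succ n)).symm⟩

/-! ### Random access machines with bit costs

A program works on registers `0, 1, 2, …`, each of which holds a natural number, and has random
access to a read-only input word. Control flow is structured. Every instruction is charged at least
for the lengths of all numbers that it handles, including the addresses that it computes, and for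
multiplication and division the square of these lengths. -/

/-- The contents of the registers. -/
abbrev State := ℕ → ℕ

/-- The basic instructions; `R` stands for the registers and `x` for the input word. -/
inductive Instr : Type
  /-- `R[d] := n` -/
  | const (d n : ℕ)
  /-- `R[d] := R[a] + R[b]` -/
  | add (d a b : ℕ)
  /-- `R[d] := max (R[a] - R[b]) 0` -/
  | sub (d a b : ℕ)
  /-- `R[d] := R[a] * R[b]` -/
  | mul (d a b : ℕ)
  /-- `R[d] := ⌊R[a] / R[b]⌋`, and `0` if `R[b] = 0` -/
  | div (d a b : ℕ)
  /-- `R[d] := R[R[a]]` -/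
  | load (d a : ℕ)
  /-- `R[R[a]] := R[b]` -/
  | store (a b : ℕ)
  /-- `R[d] := x[R[a]]`, the symbol at position `R[a]` counted from `0`; `0` beyond the end -/
  | input (d a : ℕ)
  /-- `R[d] := |x|` -/
  | inputLen (d : ℕ)

/-- The registers after one basic instruction. -/
def Instr.exec (x : List Bool) (s : State) : Instr → State
  | const d n => Function.update s d n
  | add d a b => Function.update s d (s a + s b)
  | sub d a b => Function.update s d (s a - s b)
  | mul d a b => Function.update s d (s a * s b)
  | div d a b => Function.update s d (s a / s b)
  | load d a => Function.update s d (s (s a))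
  | store a b => Function.update s (s a) (s b)
  | input d a => Function.update s d (x.getD (s a) false).toNat
  | inputLen d => Function.update s d x.length

/-- The cost of one basic instruction; `Nat.size` is the length of the binary expansion. -/
def Instr.cost (x : List Bool) (s : State) : Instr → ℕ
  | const _ n => 1 + n.size
  | add _ a b => 1 + (s a).size + (s b).size
  | sub _ a b => 1 + (s a).size + (s b).size
  | mul _ a b => (1 + (s a).size + (s b).size) ^ 2
  | div _ a b => (1 + (s a).size + (s b).size) ^ 2
  | load _ a => 1 + (s a).size + (s (s a)).size
  | store a b => 1 + (s a).size + (s b).size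
  | input _ a => 1 + (s a).size
  | inputLen _ => 1 + x.length.size

/-- Programs. -/
inductive Program : Type
  | instr (i : Instr)
  | seq (p q : Program)
  /-- run `p` if `R[a] ≠ 0`, and `q` otherwise -/
  | cond (a : ℕ) (p q : Program)
  /-- run `p` as long as `R[a] ≠ 0` -/
  | loop (a : ℕ) (p : Program)

/-- `Exec x p s s' t`: on the input word `x`, the program `p` started with the registers `s` halts
with the registers `s'`, at total cost `t`. -/
inductive Exec (x : List Bool) : Program → State → State → ℕ → Prop
  | instr (i : Instr) (s : State) : Exec x (.instr i) s (i.exec x s) (i.cost x s)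
  | seq {p q : Program} {s s' s'' : State} {t t' : ℕ} :
      Exec x p s s' t → Exec x q s' s'' t' → Exec x (.seq p q) s s'' (t + t')
  | condTrue {a : ℕ} {p q : Program} {s s' : State} {t : ℕ} :
      s a ≠ 0 → Exec x p s s' t → Exec x (.cond a p q) s s' (1 + (s a).size + t)
  | condFalse {a : ℕ} {p q : Program} {s s' : State} {t : ℕ} :
      s a = 0 → Exec x q s s' t → Exec x (.cond a p q) s s' (1 + t)
  | loopStep {a : ℕ} {p : Program} {s s' s'' : State} {t t' : ℕ} :
      s a ≠ 0 → Exec x p s s' t → Exec x (.loop a p) s' s'' t' →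
        Exec x (.loop a p) s s'' (1 + (s a).size + t + t')
  | loopDone {a : ℕ} {p : Program} {s : State} : s a = 0 → Exec x (.loop a p) s s 1

/-! ### Parameterized problems -/

/-- A parameterized decision problem: its instances, their encodings as words, the parameter of an
instance, and the yes-instances. -/
structure ParamProblem where
  Inst : Type
  encode : Inst → List Bool
  param : Inst → ℕ
  Yes : Inst → Prop

/-- `P` can be solved in time `O*(g(κ))`, with `κ` the parameter: some program, started with all
registers `0`, halts on (the encoding of) every instance after time at most `g(κ)` times a fixed
polynomial in the length of the encoding, with `1` in register `0` exactly for yes-instances. -/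
def ParamProblem.SolvableInOStar (P : ParamProblem) (g : ℕ → ℕ) : Prop :=
  ∃ (prog : Program) (q : Polynomial ℕ), ∀ I : P.Inst, ∃ (s : State) (t : ℕ),
    Exec (P.encode I) prog (fun _ => 0) s t ∧
      t ≤ g (P.param I) * q.eval (P.encode I).length ∧ (s 0 = 1 ↔ P.Yes I)

/-- Fixed-parameter tractability: time `g(κ) · |x| ^ O(1)` for a computable function `g`. -/
def ParamProblem.IsFPT (P : ParamProblem) : Prop :=
  ∃ g : ℕ → ℕ, Computable g ∧ P.SolvableInOStar g

/-! ### Group control by adding individuals -/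

/-- An instance `(N, φ, S, T, k)` with `N = {0, …, n - 1}`. -/
structure GCAIInstance where
  n : ℕ
  φ : Profile (Fin n)
  S : Finset (Fin n)
  T : Finset (Fin n)
  S_nonempty : S.Nonempty
  T_nonempty : T.Nonempty
  S_subset_T : S ⊆ T
  k : ℤ

/-- Yes-instances of GCAI for the rule `f`. -/
def GCAIInstance.Yes (f : AggregationRule) (I : GCAIInstance) : Prop :=
  ∃ U : Finset (Fin I.n), Disjoint U I.T ∧ (U.card : ℤ) ≤ I.k ∧
    (I.S : Set (Fin I.n)) ⊆ f.select (Fin I.n) I.φ ((I.T : Set (Fin I.n)) ∪ (U : Set (Fin I.n)))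

/-- The encoding of an instance: `n` ones and a zero, the matrix of the profile row by row, the
indicator words of `S` and of `T`, the sign of `k` (`1` for negative), and the binary expansion of
`|k|`, least significant bit first. -/
def GCAIInstance.encode (I : GCAIInstance) : List Bool :=
  List.replicate I.n true ++ [false] ++
    (List.finRange I.n).flatMap (fun a => (List.finRange I.n).map (I.φ a)) ++
    (List.finRange I.n).map (fun a => decide (a ∈ I.S)) ++
    (List.finRange I.n).map (fun a => decide (a ∈ I.T)) ++
    [decide (I.k < 0)] ++ I.k.natAbs.bits

/-- GCAI for the rule `f`, parameterized by the number of distinguished individuals. -/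
def gcai (f : AggregationRule) : ParamProblem where
  Inst := GCAIInstance
  encode := GCAIInstance.encode
  param I := I.S.card
  Yes := GCAIInstance.Yes f

end GroupControl

/-!
The consensus-start-respecting rule on `T ∪ U` selects all of `S` if and only if some `r ∈ T ∪ U`
is qualified by everybody in `T ∪ U` and leads to all of `S` inside `T ∪ U`: any two members of the
first stage qualify each other, so a single one of them already starts the whole procedure. For a
fixed `r`, finding a smallest `U` is thus a node-weighted directed Steiner tree problem with root
`r` and terminals `S` in the digraph of those who qualify `r`.

The existence of a cheap tree is decided by counting branching walks, that is, homomorphic images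
of rooted trees (`walks`). They satisfy two requirements: a branching walk of small weight visits
few individuals outside `T` and reaches every individual it visits (`walks_sound`), and all
selected individuals lie on one branching walk that visits nobody twice (`insert_mem_walks`); both
enter `GCAIInstance.yes_iff`. Unlike trees, branching walks that avoid a given set `X` are counted
by a recursion with polynomially many values (`avoiding_eq`), because the two parts of a grafted
walk are independent. By inclusion–exclusion (`sum_powerset_avoiding`), the
alternating sum of these counts over all `X ⊆ S` is the number of branching walks that visit all of
`S`, and it costs `2 ^ ℓ` evaluations of the recursion.

One weight function handles both the size of a walk and its cost: everybody weighs `1`, and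
individuals outside `T` weigh `n` more. Then `O(n²)` weights matter, and the counts have
polynomially many digits (`avoiding_le`).

For the machine model, arithmetic expressions with bounded sums and products are compiled to
programs (`Exp.code`). Since every sum runs over at most as many indices as the input word has
symbols, an expression costs polynomial time in the lengths of the values it starts from, whatever
these values are (`Exp.runs_code`). The algorithm itself then consists of two nested counted loops
(`solver`), and what remains to be bounded are the lengths of the table entries and of the two
accumulated sums.
-/

namespace GroupControl

open Finset Function

/-! ### Running time of programs -/

/-- The program `p` takes the registers `s` to `s'` at cost at most `c`. -/
def Runs (x : List Bool) (p : Program) (s s' : State) (c : ℕ) : Prop :=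
  ∃ t ≤ c, Exec x p s s' t

theorem Runs.instr {x : List Bool} {i : Instr} {s s' : State} {c : ℕ}
    (hs : i.exec x s = s') (hc : i.cost x s ≤ c) : Runs x (.instr i) s s' c :=
  ⟨_, hc, hs ▸ Exec.instr i s⟩

theorem Runs.seq {x : List Bool} {p q : Program} {s s' s'' : State} {c c' : ℕ}
    (h : Runs x p s s' c) (h' : Runs x q s' s'' c') : Runs x (.seq p q) s s'' (c + c') := by
  obtain ⟨t, ht, e⟩ := h
  obtain ⟨t', ht', e'⟩ := h'
  exact ⟨_, Nat.add_le_add ht ht', .seq e e'⟩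

theorem Runs.mono {x : List Bool} {p : Program} {s s' : State} {c c' : ℕ}
    (h : Runs x p s s' c) (hc : c ≤ c') : Runs x p s s' c' := by
  obtain ⟨t, ht, e⟩ := h
  exact ⟨t, ht.trans hc, e⟩

/-- The rule for a loop whose control register counts down from `m`: every round costs at most `c`
and preserves the invariant `I`. -/
theorem Runs.loop {x : List Bool} {p : Program} {a c : ℕ} (I : ℕ → State → Prop) (m : ℕ)
    (hI : ∀ j s, j ≤ m → I j s → s a = m - j)
    (hp : ∀ j s, j < m → I j s → ∃ s', Runs x p s s' c ∧ I (j + 1) s')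
    {s : State} (hs : I 0 s) :
    ∃ s', Runs x (.loop a p) s s' (m * (1 + m.size + c) + 1) ∧ I m s' := by
  suffices H : ∀ d j s, j + d = m → I j s →
      ∃ s', Runs x (.loop a p) s s' (d * (1 + m.size + c) + 1) ∧ I m s' from
    H m 0 s (by simp) hs
  intro d
  induction d with
  | zero =>
    intro j s hj h
    obtain rfl : j = m := by simpa using hj
    exact ⟨s, ⟨1, by simp, .loopDone (by simpa using hI j s le_rfl h)⟩, h⟩
  | succ d ih =>
    intro j s hj h
    have hsa := hI j s (by omega) h
    obtain ⟨s', ⟨t, ht, e⟩, h'⟩ := hp j s (by omega) h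
    obtain ⟨s'', ⟨t', ht', e'⟩, h''⟩ := ih (j + 1) s' (by omega) h'
    refine ⟨s'', ⟨_, ?_, .loopStep (by omega) e e'⟩, h''⟩
    have : (s a).size ≤ m.size := Nat.size_le_size (by omega)
    rw [add_mul, one_mul]
    omega

/-- A straight-line sequence of instructions in front of a program. -/
def block (l : List Instr) (p : Program) : Program := l.foldr (fun i q => .seq (.instr i) q) p

/-! ### Binary lengths -/

theorem size_add_le (a b : ℕ) : (a + b).size ≤ a.size + b.size + 1 := by
  rw [Nat.size_le]
  have ha := Nat.lt_size_self a
  have hb := Nat.lt_size_self b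
  have h1 : 2 ^ a.size ≤ 2 ^ (a.size + b.size) := Nat.pow_le_pow_right two_pos (by omega)
  have h2 : 2 ^ b.size ≤ 2 ^ (a.size + b.size) := Nat.pow_le_pow_right two_pos (by omega)
  rw [pow_succ]
  omega

theorem size_mul_le (a b : ℕ) : (a * b).size ≤ a.size + b.size := by
  rw [Nat.size_le, pow_add]
  exact Nat.mul_lt_mul'' (Nat.lt_size_self a) (Nat.lt_size_self b)

theorem size_le_self (n : ℕ) : n.size ≤ n := Nat.size_le.2 n.lt_two_pow_self

/-! ### Expressions -/

/-- The arithmetic operations of the machine. -/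
inductive Op
  | add | sub | mul | div

/-- The function computed by an operation. -/
def Op.fn : Op → ℕ → ℕ → ℕ
  | add => (· + ·)
  | sub => (· - ·)
  | mul => (· * ·)
  | div => (· / ·)

/-- The instruction for an operation. -/
def Op.instr : Op → ℕ → ℕ → ℕ → Instr
  | add => .add
  | sub => .sub
  | mul => .mul
  | div => .div

theorem Op.exec_instr (o : Op) (x : List Bool) (s : State) (d a b : ℕ) :
    (o.instr d a b).exec x s = update s d (o.fn (s a) (s b)) := by
  cases o <;> rfl

theorem Op.cost_instr_le (o : Op) (x : List Bool) (s : State) (d a b : ℕ) :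
    (o.instr d a b).cost x s ≤ (1 + (s a).size + (s b).size) ^ 2 := by
  cases o <;> simp only [Op.instr, Instr.cost] <;> nlinarith

theorem Op.size_fn_le (o : Op) (a b : ℕ) : (o.fn a b).size ≤ a.size + b.size + 1 := by
  cases o
  · exact size_add_le a b
  · exact (Nat.size_le_size (Nat.sub_le a b)).trans (by omega)
  · exact (size_mul_le a b).trans (by omega)
  · exact (Nat.size_le_size (Nat.div_le_self a b)).trans (by omega)

/-- The fold of `f 0, …, f (m - 1)` with an operation, starting from `z`. -/
def Op.fold (o : Op) (z : ℕ) (f : ℕ → ℕ) : ℕ → ℕ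
  | 0 => z
  | m + 1 => o.fn (o.fold z f m) (f m)

theorem Op.size_fold_le (o : Op) (z : ℕ) (f : ℕ → ℕ) {c m : ℕ} (hf : ∀ j < m, (f j).size ≤ c) :
    (o.fold z f m).size ≤ z.size + m * (c + 1) := by
  induction m with
  | zero => simp [fold]
  | succ m ih =>
    have h1 := ih fun j hj => hf j (by omega)
    have h2 := hf m (by omega)
    refine (o.size_fn_le _ _).trans ?_
    rw [add_mul]
    omega

theorem Op.fold_add (f : ℕ → ℕ) (m : ℕ) : Op.add.fold 0 f m = ∑ j ∈ range m, f j := by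
  induction m with
  | zero => rfl
  | succ m ih => rw [sum_range_succ, ← ih]; rfl

theorem Op.fold_mul (f : ℕ → ℕ) (m : ℕ) : Op.mul.fold 1 f m = ∏ j ∈ range m, f j := by
  induction m with
  | zero => rfl
  | succ m ih => rw [prod_range_succ, ← ih]; rfl

/-- Arithmetic expressions over variables `ρ`, one array `A` and the input word. `big o z i b e`
folds the values of `e` at `i = 0, …, b - 1` with the operation `o`, starting from `z`; the number
of rounds is capped at the length of the input word, so that an expression is always evaluated in
polynomial time. -/
inductive Exp
  | lit (n : ℕ)
  | var (i : ℕ)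
  | len
  | arr (e : Exp)
  | inp (e : Exp)
  | bin (o : Op) (e f : Exp)
  | big (o : Op) (z i : ℕ) (b e : Exp)

/-- The value of an expression. -/
def Exp.eval (x : List Bool) : Exp → (ℕ → ℕ) → (ℕ → ℕ) → ℕ
  | lit n, _, _ => n
  | var i, ρ, _ => ρ i
  | len, _, _ => x.length
  | arr e, ρ, A => A (e.eval x ρ A)
  | inp e, ρ, A => (x.getD (e.eval x ρ A) false).toNat
  | bin o e f, ρ, A => o.fn (e.eval x ρ A) (f.eval x ρ A)
  | big o z i b e, ρ, A =>
      o.fold z (fun j => e.eval x (update ρ i j) A) (min (b.eval x ρ A) x.length)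

/-- All variables and all entries of the array have binary length at most `L`. -/
def Bounded (L : ℕ) (ρ A : ℕ → ℕ) : Prop := (∀ i, (ρ i).size ≤ L) ∧ ∀ i, (A i).size ≤ L

theorem Bounded.update {L : ℕ} {ρ A : ℕ → ℕ} (h : Bounded L ρ A) (i : ℕ) {v : ℕ}
    (hv : v.size ≤ L) : Bounded L (update ρ i v) A := by
  refine ⟨fun j => ?_, h.2⟩
  by_cases e : j = i
  · subst e; simpa using hv
  · simpa [e] using h.1 j

/-- The value of an expression has binary length polynomial in the length of the input word and of
the values it starts from. -/
theorem Exp.size_eval_le (e : Exp) : ∃ q : Polynomial ℕ, ∀ (x : List Bool) (L : ℕ) (ρ A : ℕ → ℕ),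
    x.length ≤ L → Bounded L ρ A → (e.eval x ρ A).size ≤ q.eval L := by
  induction e with
  | lit n => exact ⟨.C n.size, fun x L ρ A _ _ => by simp [eval]⟩
  | var i => exact ⟨.X, fun x L ρ A _ h => by simpa [eval] using h.1 i⟩
  | len => exact ⟨.X, fun x L ρ A hx _ => by simpa [eval] using (size_le_self _).trans hx⟩
  | arr e _ => exact ⟨.X, fun x L ρ A _ h => by simpa [eval] using h.2 _⟩
  | inp e _ =>
    refine ⟨1, fun x L ρ A _ h => ?_⟩
    simp only [eval, Polynomial.eval_one]
    exact (size_le_self _).trans (Bool.toNat_le _)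
  | bin o e f ihe ihf =>
    obtain ⟨qe, he⟩ := ihe
    obtain ⟨qf, hf⟩ := ihf
    refine ⟨qe + qf + 1, fun x L ρ A hx h => ?_⟩
    have := he x L ρ A hx h
    have := hf x L ρ A hx h
    have := o.size_fn_le (e.eval x ρ A) (f.eval x ρ A)
    simp only [eval, Polynomial.eval_add, Polynomial.eval_one]
    omega
  | big o z i b e _ ihe =>
    obtain ⟨qe, he⟩ := ihe
    refine ⟨.C z.size + .X * (qe + 1), fun x L ρ A hx h => ?_⟩
    simp only [eval, Polynomial.eval_add, Polynomial.eval_one, Polynomial.eval_mul,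
      Polynomial.eval_X, Polynomial.eval_C]
    have hm : min (b.eval x ρ A) x.length ≤ L := (min_le_right _ _).trans hx
    exact (o.size_fold_le z _ fun j hj => he x L _ A hx
      (h.update i ((size_le_self j).trans (hj.le.trans hm)))).trans (by gcongr)

/-! ### Compilation

Variable `i` lives in register `3 * i`, entry `i` of the array in register `3 * i + 2`, and the
registers `3 * k + 1` serve for intermediate results. -/

/-- The registers `s` hold the variables `ρ` and the array `A`. -/
def Rep (s : State) (ρ A : ℕ → ℕ) : Prop := (∀ i, s (3 * i) = ρ i) ∧ ∀ i, s (3 * i + 2) = A i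

theorem Rep.update_temp {s : State} {ρ A : ℕ → ℕ} (h : Rep s ρ A) (k v : ℕ) :
    Rep (update s (3 * k + 1) v) ρ A :=
  ⟨fun i => by rw [update_of_ne (by omega), h.1], fun i => by rw [update_of_ne (by omega), h.2]⟩

theorem Rep.update_var {s : State} {ρ A : ℕ → ℕ} (h : Rep s ρ A) (i v : ℕ) :
    Rep (update s (3 * i) v) (update ρ i v) A := by
  refine ⟨fun j => ?_, fun j => by rw [update_of_ne (by omega), h.2]⟩
  by_cases e : j = i
  · subst e; simp
  · rw [update_of_ne (by omega), update_of_ne e, h.1]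

theorem Rep.update_arr {s : State} {ρ A : ℕ → ℕ} (h : Rep s ρ A) (i v : ℕ) :
    Rep (update s (3 * i + 2) v) ρ (update A i v) := by
  refine ⟨fun j => by rw [update_of_ne (by omega), h.1], fun j => ?_⟩
  by_cases e : j = i
  · subst e; simp
  · rw [update_of_ne (by omega), update_of_ne e, h.2]

/-- The intermediate results below level `k` are the same in `s` and `s'`. -/
def SameTemps (k : ℕ) (s s' : State) : Prop := ∀ j < k, s' (3 * j + 1) = s (3 * j + 1)

theorem SameTemps.trans {k : ℕ} {s s' s'' : State} (h : SameTemps k s s')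
    (h' : SameTemps k s' s'') : SameTemps k s s'' := fun j hj => (h' j hj).trans (h j hj)

theorem SameTemps.mono {k l : ℕ} {s s' : State} (h : SameTemps l s s') (hk : k ≤ l) :
    SameTemps k s s' := fun j hj => h j (hj.trans_le hk)

/-- Code that puts the value of an expression into the register `3 * k + 1` and uses only
intermediate registers from level `k` on. -/
def Exp.code : Exp → ℕ → Program
  | lit n, k => .instr (.const (3 * k + 1) n)
  | var i, k => block [.const (3 * k + 1) 0] (.instr (.add (3 * k + 1) (3 * i) (3 * k + 1)))
  | len, k => .instr (.inputLen (3 * k + 1))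
  | arr e, k => .seq (e.code k) (block [.const (3 * (k + 1) + 1) 3,
      .mul (3 * k + 1) (3 * k + 1) (3 * (k + 1) + 1), .const (3 * (k + 1) + 1) 2,
      .add (3 * k + 1) (3 * k + 1) (3 * (k + 1) + 1)] (.instr (.load (3 * k + 1) (3 * k + 1))))
  | inp e, k => .seq (e.code k) (.instr (.input (3 * k + 1) (3 * k + 1)))
  | bin o e f, k => .seq (e.code k) (.seq (f.code (k + 1))
      (.instr (o.instr (3 * k + 1) (3 * k + 1) (3 * (k + 1) + 1))))
  | big o z i b e, k => .seq (b.code (k + 1)) (.seq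
      (block [.inputLen (3 * (k + 2) + 1),
        .sub (3 * (k + 3) + 1) (3 * (k + 1) + 1) (3 * (k + 2) + 1),
        .sub (3 * (k + 1) + 1) (3 * (k + 1) + 1) (3 * (k + 3) + 1),
        .const (3 * (k + 3) + 1) 0,
        .add (3 * (k + 2) + 1) (3 * i) (3 * (k + 3) + 1),
        .const (3 * k + 1) z] (.instr (.const (3 * i) 0)))
      (.seq
        (.loop (3 * (k + 1) + 1) (.seq (e.code (k + 3))
          (block [o.instr (3 * k + 1) (3 * k + 1) (3 * (k + 3) + 1),
            .const (3 * (k + 3) + 1) 1,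
            .add (3 * i) (3 * i) (3 * (k + 3) + 1)]
            (.instr (.sub (3 * (k + 1) + 1) (3 * (k + 1) + 1) (3 * (k + 3) + 1))))))
        (block [.const (3 * (k + 3) + 1) 0]
          (.instr (.add (3 * i) (3 * (k + 2) + 1) (3 * (k + 3) + 1))))))

theorem Runs.block_cons {x : List Bool} {i : Instr} {l : List Instr} {p : Program} {s s' : State}
    {c c' : ℕ} (hc : i.cost x s ≤ c) (h : Runs x (block l p) (i.exec x s) s' c') :
    Runs x (block (i :: l) p) s s' (c + c') :=
  (Runs.instr rfl hc).seq h

/-- The code of an expression computes its value in polynomial time. -/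
theorem Exp.runs_code (e : Exp) : ∀ k : ℕ, ∃ q : Polynomial ℕ, ∀ (x : List Bool) (L : ℕ)
    (s : State) (ρ A : ℕ → ℕ), x.length ≤ L → Bounded L ρ A → Rep s ρ A →
    ∃ s', Runs x (e.code k) s s' (q.eval L) ∧ Rep s' ρ A ∧ s' (3 * k + 1) = e.eval x ρ A ∧
      SameTemps k s s' := by
  induction e with
  | lit n =>
    refine fun k => ⟨.C (1 + n.size), fun x L s ρ A hx hb hs => ⟨_, .instr rfl ?_,
      hs.update_temp k n, by simp [eval, Instr.exec], fun j hj => update_of_ne (by omega) _ _⟩⟩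
    simp [Instr.cost]
  | var i =>
    refine fun k => ⟨1 + (1 + .X), fun x L s ρ A hx hb hs => ⟨_, ?_,
      (hs.update_temp k 0).update_temp k (ρ i), by simp [eval], fun j hj => ?_⟩⟩
    · simp only [Polynomial.eval_add, Polynomial.eval_one, Polynomial.eval_X]
      refine .block_cons (by simp [Instr.cost]) (.instr ?_ ?_)
      · simp only [Instr.exec]
        rw [update_of_ne (by omega), hs.1]
        simp
      · simp only [Instr.cost, Instr.exec]
        rw [update_of_ne (by omega), hs.1]
        simpa using hb.1 i
    · rw [update_of_ne (by omega), update_of_ne (by omega)]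
  | len =>
    refine fun k => ⟨1 + .X, fun x L s ρ A hx hb hs => ⟨_, .instr rfl ?_,
      hs.update_temp k _, by simp [eval, Instr.exec], fun j hj => update_of_ne (by omega) _ _⟩⟩
    simpa [Instr.cost] using (size_le_self _).trans hx
  | arr e ih =>
    intro k
    obtain ⟨q, hq⟩ := ih k
    obtain ⟨r, hr⟩ := e.size_eval_le
    refine ⟨q + (3 + ((1 + r + 2) ^ 2 + (3 + ((1 + (r + 2) + 2) + (1 + ((r + 2) + 2 + 1) + .X))))),
      fun x L s ρ A hx hb hs => ?_⟩
    obtain ⟨s₁, h₁, hs₁, hv, ht⟩ := hq x L s ρ A hx hb hs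
    have hr := hr x L ρ A hx hb
    set v := e.eval x ρ A with hv'
    have h3 : (3 : ℕ).size = 2 := by decide
    have h2 : (2 : ℕ).size = 2 := by decide
    have hm : (v * 3).size ≤ r.eval L + 2 := (size_mul_le v 3).trans (by omega)
    have ha : (v * 3 + 2).size ≤ r.eval L + 2 + 2 + 1 := (size_add_le _ 2).trans (by omega)
    have ne1 : 3 * k + 1 ≠ 3 * (k + 1) + 1 := by omega
    have hA : s₁ (v * 3 + 2) = A v := by rw [mul_comm]; exact hs₁.2 v
    refine ⟨update (update s₁ (3 * (k + 1) + 1) 2) (3 * k + 1) (A v), ?_,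
      (hs₁.update_temp _ _).update_temp _ _, by simp [eval, ← hv'], fun j hj => ?_⟩
    · simp only [Polynomial.eval_add, Polynomial.eval_one, Polynomial.eval_X, Polynomial.eval_pow,
        Polynomial.eval_ofNat]
      refine h₁.seq (.block_cons ?_ (.block_cons ?_ (.block_cons ?_ (.block_cons ?_
        (.instr ?_ ?_)))))
      · simp [Instr.cost, h3]
      · simp only [Instr.cost, Instr.exec, update_self, update_of_ne ne1, hv, h3]
        gcongr
      · simp [Instr.cost, h2]
      · simp only [Instr.cost, Instr.exec, update_self, update_of_ne ne1, hv, h2]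
        omega
      · simp only [Instr.exec, update_self, update_of_ne ne1, hv]
        rw [update_of_ne (by omega), update_of_ne (by omega), update_of_ne (by omega),
          update_of_ne (by omega), hA]
        ext j
        simp only [update_apply]
        split_ifs <;> rfl
      · simp only [Instr.cost, Instr.exec, update_self, update_of_ne ne1, hv]
        rw [update_of_ne (by omega), update_of_ne (by omega), update_of_ne (by omega),
          update_of_ne (by omega), hA]
        have := hb.2 v
        omega
    · rw [update_of_ne (by omega), update_of_ne (by omega), ht j hj]
  | inp e ih =>
    intro k
    obtain ⟨q, hq⟩ := ih k
    obtain ⟨r, hr⟩ := e.size_eval_le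
    refine ⟨q + (1 + r), fun x L s ρ A hx hb hs => ?_⟩
    obtain ⟨s₁, h₁, hs₁, hv, ht⟩ := hq x L s ρ A hx hb hs
    refine ⟨_, ?_, hs₁.update_temp k (x.getD (e.eval x ρ A) false).toNat, by simp [eval],
      fun j hj => ?_⟩
    · simp only [Polynomial.eval_add, Polynomial.eval_one]
      refine h₁.seq (.instr (by rw [Instr.exec, hv]) ?_)
      simpa [Instr.cost, hv] using hr x L ρ A hx hb
    · rw [update_of_ne (by omega), ht j hj]
  | bin o e f ihe ihf =>
    intro k
    obtain ⟨q, hq⟩ := ihe k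
    obtain ⟨q', hq'⟩ := ihf (k + 1)
    obtain ⟨r, hr⟩ := e.size_eval_le
    obtain ⟨r', hr'⟩ := f.size_eval_le
    refine ⟨q + (q' + (1 + r + r') ^ 2), fun x L s ρ A hx hb hs => ?_⟩
    obtain ⟨s₁, h₁, hs₁, hv, ht⟩ := hq x L s ρ A hx hb hs
    obtain ⟨s₂, h₂, hs₂, hv₂, ht₂⟩ := hq' x L s₁ ρ A hx hb hs₁
    have hk : s₂ (3 * k + 1) = e.eval x ρ A := by rw [ht₂ k (by omega), hv]
    refine ⟨_, ?_,
      hs₂.update_temp k (o.fn (e.eval x ρ A) (f.eval x ρ A)), by simp [eval], fun j hj => ?_⟩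
    · simp only [Polynomial.eval_add, Polynomial.eval_one, Polynomial.eval_pow]
      refine h₁.seq (h₂.seq (.instr (by rw [o.exec_instr, hk, hv₂]) ?_))
      refine (o.cost_instr_le x s₂ _ _ _).trans ?_
      rw [hk, hv₂]
      have := hr x L ρ A hx hb
      have := hr' x L ρ A hx hb
      gcongr
    · rw [update_of_ne (by omega), ht₂ j (by omega), ht j hj]
  | big o z i b e ihb ihe =>
    intro k
    obtain ⟨q, hq⟩ := ihb (k + 1)
    obtain ⟨q', hq'⟩ := ihe (k + 3)
    obtain ⟨r, hr⟩ := b.size_eval_le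
    obtain ⟨r', hr'⟩ := e.size_eval_le
    -- the costs of the instructions, in the order of the code; the partial results of the fold
    -- have length at most `z.size + L * (r'.eval L + 1)`
    refine ⟨q + (((1 + .X) + ((1 + r + .X) + ((1 + r + r) + (1 + ((1 + .X) +
      (.C (1 + z.size) + 1))))))
      + ((.X * (1 + .X + (q' + ((1 + (.C z.size + .X * (r' + 1)) + r') ^ 2 +
        (2 + ((1 + .X + 1) + (1 + .X + 1)))))) + 1) + (1 + (1 + .X)))),
      fun x L s ρ A hx hb hs => ?_⟩
    simp only [Polynomial.eval_add, Polynomial.eval_one, Polynomial.eval_mul, Polynomial.eval_X,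
      Polynomial.eval_C, Polynomial.eval_pow, Polynomial.eval_ofNat]
    obtain ⟨s₁, h₁, hs₁, hv, ht⟩ := hq x L s ρ A hx hb hs
    have hr := hr x L ρ A hx hb
    have e1 : ∀ a b : ℕ, (3 * a = 3 * b + 1) = False := fun a b => by simp; omega
    have e2 : ∀ a b : ℕ, (3 * b + 1 = 3 * a) = False := fun a b => by simp; omega
    have hlen : x.length.size ≤ L := (size_le_self _).trans hx
    set v := b.eval x ρ A with hv'
    set m := min v x.length with hm
    have hmL : m ≤ L := (min_le_right _ _).trans hx
    set f := fun j => e.eval x (update ρ i j) A with hf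
    have hfj : ∀ j < m, (f j).size ≤ r'.eval L := fun j hj =>
      hr' x L _ A hx (hb.update i ((size_le_self j).trans (hj.le.trans hmL)))
    let I : ℕ → State → Prop := fun j t => Rep t (update ρ i j) A ∧ t (3 * (k + 1) + 1) = m - j ∧
      t (3 * (k + 2) + 1) = ρ i ∧ t (3 * k + 1) = o.fold z f j ∧ SameTemps k s t
    -- the preparation of the loop
    obtain ⟨s₂, h₂, hI⟩ : ∃ s₂, Runs x (block [.inputLen (3 * (k + 2) + 1),
        .sub (3 * (k + 3) + 1) (3 * (k + 1) + 1) (3 * (k + 2) + 1),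
        .sub (3 * (k + 1) + 1) (3 * (k + 1) + 1) (3 * (k + 3) + 1),
        .const (3 * (k + 3) + 1) 0,
        .add (3 * (k + 2) + 1) (3 * i) (3 * (k + 3) + 1),
        .const (3 * k + 1) z] (.instr (.const (3 * i) 0))) s₁ s₂ ((1 + L) + ((1 + r.eval L + L) +
        ((1 + r.eval L + r.eval L) + (1 + ((1 + L) + (1 + z.size + 1)))))) ∧ I 0 s₂ := by
      refine ⟨_, .block_cons ?_ (.block_cons ?_ (.block_cons ?_ (.block_cons ?_ (.block_cons ?_
        (.block_cons ?_ (.instr rfl ?_)))))), ?_, ?_, ?_, ?_, ?_⟩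
      · simpa [Instr.cost] using hlen
      · simp [Instr.cost, Instr.exec, hv]
        omega
      · have := (Nat.size_le_size (Nat.sub_le v x.length)).trans hr
        simp [Instr.cost, Instr.exec, hv]
        omega
      · simp [Instr.cost]
      · simp [Instr.cost, Instr.exec, e1, hs₁.1 i, hb.1 i]
      · simp [Instr.cost]
      · simp [Instr.cost]
      · exact Rep.update_var ((((((hs₁.update_temp _ _).update_temp _ _).update_temp _
          _).update_temp _ _).update_temp _ _).update_temp _ _) i 0
      · simp [Instr.exec, e1, e2, hv, hm]
        omega
      · simp [Instr.exec, e1, e2, hs₁.1 i]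
      · simp [Instr.exec, e1, e2, Op.fold]
      · intro j hj
        have hne : ∀ d, (j = k + d) = False := fun d => by simp; omega
        simp [Instr.exec, e1, e2, hne, show j ≠ k by omega, ht j (by omega)]
    -- the loop
    obtain ⟨s₃, h₃, hI₃⟩ := Runs.loop (x := x) (a := 3 * (k + 1) + 1)
      (p := .seq (e.code (k + 3)) (block [o.instr (3 * k + 1) (3 * k + 1) (3 * (k + 3) + 1),
            .const (3 * (k + 3) + 1) 1, .add (3 * i) (3 * i) (3 * (k + 3) + 1)]
            (.instr (.sub (3 * (k + 1) + 1) (3 * (k + 1) + 1) (3 * (k + 3) + 1)))))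
      (c := q'.eval L + ((1 + (z.size + L * (r'.eval L + 1)) + r'.eval L) ^ 2 +
        (2 + ((1 + L + 1) + (1 + L + 1))))) I m (fun j t _ h => h.2.1)
      (fun j t hj ⟨it, i1, i2, i3, i4⟩ => by
        have hjL : j.size ≤ L := (size_le_self j).trans (hj.le.trans hmL)
        obtain ⟨t', g, gt, gv, gs⟩ := hq' x L t (update ρ i j) A hx (hb.update i hjL) it
        have g0 := (gs k (by omega)).trans i3
        have g1 := (gs (k + 1) (by omega)).trans i1
        have g2 := (gs (k + 2) (by omega)).trans i2
        have gi : t' (3 * i) = j := by rw [gt.1 i]; simp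
        have hone : (1 : ℕ).size = 1 := Nat.size_one
        refine ⟨_, g.seq (.block_cons ?_ (.block_cons ?_ (.block_cons ?_ (.instr rfl ?_)))),
          ?_, ?_, ?_, ?_, ?_⟩
        · refine (o.cost_instr_le x t' _ _ _).trans ?_
          rw [g0, gv]
          have h1 := (o.size_fold_le z f fun l hl => hfj l (hl.trans hj)).trans
            (show _ ≤ z.size + L * (r'.eval L + 1) by have := hj.le.trans hmL; gcongr)
          have h2 := hfj j hj
          gcongr
        · simp [Instr.cost, hone]
        · simp only [Op.exec_instr]
          simp [Instr.cost, Instr.exec, e1, gi, hone]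
          exact hjL
        · have : (m - j).size ≤ L := (size_le_self _).trans (by omega)
          simp only [Op.exec_instr]
          simp [Instr.cost, Instr.exec, e1, e2, g1, hone]
          exact this
        · have := (((gt.update_temp k (o.fn (o.fold z f j) (f j))).update_temp (k + 3) 1).update_var
            i (j + 1)).update_temp (k + 1) (m - j - 1)
          simp only [Op.exec_instr]
          simpa [Instr.exec, e1, e2, update_apply, g0, gv, gi, g1] using this
        · simp only [Op.exec_instr]
          simp [Instr.exec, e1, e2, g1]
          omega
        · simp only [Op.exec_instr]
          simp [Instr.exec, e1, e2, g2]
        · simp only [Op.exec_instr]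
          simp [Instr.exec, e1, e2, g0, gv, Op.fold, hf]
        · intro l hl
          have hne : ∀ d, (l = k + d) = False := fun d => by simp; omega
          simp only [Op.exec_instr]
          simp [Instr.exec, e1, e2, hne, show l ≠ k by omega,
            gs l (by omega), i4 l hl]) hI
    obtain ⟨i0, i1, i2, i3, i4⟩ := hI₃
    -- the loop variable gets its old value back
    refine ⟨_, h₁.seq (h₂.seq ((h₃.mono ?_).seq (.block_cons ?_ (.instr rfl ?_)))),
      ?_, ?_, ?_⟩
    · have : m.size ≤ L := (size_le_self _).trans hmL
      gcongr
    · simp [Instr.cost]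
    · simp [Instr.cost, Instr.exec, i2, hb.1 i]
    · have := (i0.update_temp (k + 3) 0).update_var i (ρ i)
      simpa [Instr.exec, update_apply, i2] using this
    · simp [Instr.exec, e2, i3, eval, hf, ← hm, ← hv']
    · intro l hl
      have hne : ∀ d, (l = k + d) = False := fun d => by simp; omega
      simp [Instr.exec, e2, hne, i4 l hl]

/-! ### Assignments and counted loops -/

/-- Started with variables and an array that satisfy `P`, the program `p` reaches ones that satisfy
`Q` at cost at most `c`, and keeps the intermediate results below level `k`. -/
def Spec (x : List Bool) (k : ℕ) (p : Program) (P Q : (ℕ → ℕ) → (ℕ → ℕ) → Prop) (c : ℕ) : Prop :=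
  ∀ s ρ A, Rep s ρ A → P ρ A →
    ∃ s' ρ' A', Runs x p s s' c ∧ Rep s' ρ' A' ∧ Q ρ' A' ∧ SameTemps k s s'

theorem Spec.seq {x : List Bool} {k c c' : ℕ} {p p' : Program}
    {P Q R : (ℕ → ℕ) → (ℕ → ℕ) → Prop} (h : Spec x k p P Q c) (h' : Spec x k p' Q R c') :
    Spec x k (.seq p p') P R (c + c') := by
  intro s ρ A hs hP
  obtain ⟨s₁, ρ₁, A₁, r₁, hs₁, hQ, ht₁⟩ := h s ρ A hs hP
  obtain ⟨s₂, ρ₂, A₂, r₂, hs₂, hR, ht₂⟩ := h' s₁ ρ₁ A₁ hs₁ hQ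
  exact ⟨s₂, ρ₂, A₂, r₁.seq r₂, hs₂, hR, ht₁.trans ht₂⟩

/-- `var i := e` -/
def assign (i : ℕ) (e : Exp) (k : ℕ) : Program :=
  .seq (e.code k) (block [.const (3 * (k + 1) + 1) 0]
    (.instr (.add (3 * i) (3 * k + 1) (3 * (k + 1) + 1))))

theorem spec_assign (i : ℕ) (e : Exp) (k : ℕ) : ∃ q : Polynomial ℕ,
    ∀ (x : List Bool) (L : ℕ) (P Q : (ℕ → ℕ) → (ℕ → ℕ) → Prop), x.length ≤ L →
      (∀ ρ A, P ρ A → Bounded L ρ A ∧ Q (update ρ i (e.eval x ρ A)) A) →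
      Spec x k (assign i e k) P Q (q.eval L) := by
  obtain ⟨q, hq⟩ := e.runs_code k
  obtain ⟨r, hr⟩ := e.size_eval_le
  refine ⟨q + (1 + (1 + r)), fun x L P Q hx h s ρ A hs hP => ?_⟩
  obtain ⟨hb, hQ⟩ := h ρ A hP
  obtain ⟨s₁, h₁, hs₁, hv, ht⟩ := hq x L s ρ A hx hb hs
  have hr := hr x L ρ A hx hb
  simp only [Polynomial.eval_add, Polynomial.eval_one]
  refine ⟨_, _, A, h₁.seq (.block_cons ?_ (.instr ?_ ?_)),
    (hs₁.update_temp (k + 1) 0).update_var i _, hQ, ?_⟩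
  · simp [Instr.cost]
  · simp [Instr.exec, hv]
  · simpa [Instr.cost, Instr.exec, hv] using hr
  · intro j hj
    rw [update_of_ne (by omega), update_of_ne (by omega), ht j hj]

/-- `arr e := f` -/
def write (e f : Exp) (k : ℕ) : Program :=
  .seq (e.code k) (.seq (f.code (k + 1)) (block [.const (3 * (k + 2) + 1) 3,
    .mul (3 * k + 1) (3 * k + 1) (3 * (k + 2) + 1), .const (3 * (k + 2) + 1) 2,
    .add (3 * k + 1) (3 * k + 1) (3 * (k + 2) + 1)]
    (.instr (.store (3 * k + 1) (3 * (k + 1) + 1)))))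

theorem spec_write (e f : Exp) (k : ℕ) : ∃ q : Polynomial ℕ,
    ∀ (x : List Bool) (L : ℕ) (P Q : (ℕ → ℕ) → (ℕ → ℕ) → Prop), x.length ≤ L →
      (∀ ρ A, P ρ A → Bounded L ρ A ∧ Q ρ (update A (e.eval x ρ A) (f.eval x ρ A))) →
      Spec x k (write e f k) P Q (q.eval L) := by
  obtain ⟨q, hq⟩ := e.runs_code k
  obtain ⟨q', hq'⟩ := f.runs_code (k + 1)
  obtain ⟨r, hr⟩ := e.size_eval_le
  obtain ⟨r', hr'⟩ := f.size_eval_le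
  refine ⟨q + (q' + (3 + ((1 + r + 2) ^ 2 + (3 + ((1 + (r + 2) + 2) +
    (1 + ((r + 2) + 2 + 1) + r')))))), fun x L P Q hx h s ρ A hs hP => ?_⟩
  obtain ⟨hb, hQ⟩ := h ρ A hP
  obtain ⟨s₁, h₁, hs₁, hv₁, ht₁⟩ := hq x L s ρ A hx hb hs
  obtain ⟨s₂, h₂, hs₂, hv₂, ht₂⟩ := hq' x L s₁ ρ A hx hb hs₁
  have hr := hr x L ρ A hx hb
  have hr' := hr' x L ρ A hx hb
  have hk : s₂ (3 * k + 1) = e.eval x ρ A := by rw [ht₂ k (by omega), hv₁]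
  set v := e.eval x ρ A with hv'
  have h3 : (3 : ℕ).size = 2 := by decide
  have h2 : (2 : ℕ).size = 2 := by decide
  have hm : (v * 3).size ≤ r.eval L + 2 := (size_mul_le v 3).trans (by omega)
  have ha : (v * 3 + 2).size ≤ r.eval L + 2 + 2 + 1 := (size_add_le _ 2).trans (by omega)
  have ne1 : 3 * k + 1 ≠ 3 * (k + 2) + 1 := by omega
  have ne2 : 3 * (k + 1) + 1 ≠ 3 * (k + 2) + 1 := by omega
  have ne3 : 3 * (k + 1) + 1 ≠ 3 * k + 1 := by omega
  simp only [Polynomial.eval_add, Polynomial.eval_one, Polynomial.eval_pow, Polynomial.eval_ofNat]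
  refine ⟨update (update (update s₂ (3 * (k + 2) + 1) 2) (3 * k + 1) (v * 3 + 2)) (3 * v + 2)
    (f.eval x ρ A), ρ, _, h₁.seq (h₂.seq (.block_cons ?_ (.block_cons ?_ (.block_cons ?_
      (.block_cons ?_ (.instr ?_ ?_)))))),
    (((hs₂.update_temp _ _).update_temp _ _)).update_arr _ _, hQ, ?_⟩
  · simp [Instr.cost, h3]
  · simp only [Instr.cost, Instr.exec, update_self, update_of_ne ne1, hk, h3]
    gcongr
  · simp [Instr.cost, h2]
  · simp only [Instr.cost, Instr.exec, update_self, update_of_ne ne1, hk, h2]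
    omega
  · simp only [Instr.exec, update_self, update_of_ne ne1, update_of_ne ne2, update_of_ne ne3, hk,
      hv₂, mul_comm v 3]
    ext j
    simp only [update_apply]
    split_ifs <;> rfl
  · simp only [Instr.cost, Instr.exec, update_self, update_of_ne ne1, update_of_ne ne2,
      update_of_ne ne3, hk, hv₂]
    omega
  · intro j hj
    rw [update_of_ne (by omega), update_of_ne (by omega), update_of_ne (by omega), ht₂ j (by omega),
      ht₁ j hj]

/-- `for var i := 0, …, b - 1 do p`, where `p` uses intermediate registers from level `k + 3` on. -/
def forLoop (i : ℕ) (b : Exp) (p : Program) (k : ℕ) : Program :=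
  .seq (b.code k) (block [.const (3 * (k + 1) + 1) 0] (.loop (3 * k + 1)
    (block [.const (3 * (k + 2) + 1) 0, .add (3 * i) (3 * (k + 1) + 1) (3 * (k + 2) + 1)]
      (.seq p (block [.const (3 * (k + 2) + 1) 1,
        .add (3 * (k + 1) + 1) (3 * (k + 1) + 1) (3 * (k + 2) + 1)]
        (.instr (.sub (3 * k + 1) (3 * k + 1) (3 * (k + 2) + 1))))))))

/-- The rule for counted loops. The invariant `J` must not depend on the loop variable, except that
it may use that its values are less than `m`. -/
theorem spec_forLoop (i : ℕ) (b : Exp) (p : Program) (k : ℕ) : ∃ q : Polynomial ℕ,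
    ∀ (x : List Bool) (L m c : ℕ) (P : (ℕ → ℕ) → (ℕ → ℕ) → Prop)
      (J : ℕ → (ℕ → ℕ) → (ℕ → ℕ) → Prop), x.length ≤ L →
      (∀ ρ A, P ρ A → Bounded L ρ A ∧ b.eval x ρ A = m ∧ J 0 ρ A) →
      (∀ j ρ A v, v < m → J j ρ A → J j (update ρ i v) A) →
      (∀ j < m, Spec x (k + 3) p (fun ρ A => ρ i = j ∧ J j ρ A) (J (j + 1)) c) →
      Spec x k (forLoop i b p k) P (J m) (q.eval L * (m * (c + 1) + 1)) := by
  obtain ⟨q, hq⟩ := b.runs_code k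
  obtain ⟨r, hr⟩ := b.size_eval_le
  refine ⟨q + 4 * r + 10, fun x L m c P J hx h hJ hp s ρ A hs hP => ?_⟩
  obtain ⟨hb, hm, h0⟩ := h ρ A hP
  obtain ⟨s₁, h₁, hs₁, hv, ht⟩ := hq x L s ρ A hx hb hs
  have hr := hr x L ρ A hx hb
  rw [hm] at hr hv
  have e2 : ∀ a b : ℕ, (3 * b + 1 = 3 * a) = False := fun a b => by simp; omega
  have hone : (1 : ℕ).size = 1 := Nat.size_one
  let I : ℕ → State → Prop := fun j t => (∃ ρ' A', Rep t ρ' A' ∧ J j ρ' A') ∧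
    t (3 * k + 1) = m - j ∧ t (3 * (k + 1) + 1) = j ∧ SameTemps k s t
  obtain ⟨s₂, h₂, ⟨ρ₂, A₂, i0, i1⟩, -, -, i4⟩ := Runs.loop (x := x) (a := 3 * k + 1)
    (p := block [.const (3 * (k + 2) + 1) 0, .add (3 * i) (3 * (k + 1) + 1) (3 * (k + 2) + 1)]
      (.seq p (block [.const (3 * (k + 2) + 1) 1,
        .add (3 * (k + 1) + 1) (3 * (k + 1) + 1) (3 * (k + 2) + 1)]
        (.instr (.sub (3 * k + 1) (3 * k + 1) (3 * (k + 2) + 1))))))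
    (c := 1 + ((1 + r.eval L) + (c + (2 + ((1 + r.eval L + 1) + (1 + r.eval L + 1))))))
    I m (fun j t _ h => h.2.1)
    (fun j t hj ⟨⟨ρ', A', it, iJ⟩, i1, i2, i4⟩ => by
      have hjL : j.size ≤ r.eval L := (Nat.size_le_size hj.le).trans hr
      have hmj : (m - j).size ≤ r.eval L := (Nat.size_le_size (Nat.sub_le m j)).trans hr
      obtain ⟨t', ρ'', A'', g, gt, gJ, gs⟩ := hp j hj
        (update (update t (3 * (k + 2) + 1) 0) (3 * i) j) (update ρ' i j) A'
        ((it.update_temp _ _).update_var i j) ⟨by simp, hJ _ _ _ _ hj iJ⟩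
      have g0 : t' (3 * k + 1) = m - j := by simp [gs k (by omega), e2, i1]
      have g1 : t' (3 * (k + 1) + 1) = j := by simp [gs (k + 1) (by omega), e2, i2]
      refine ⟨_, .block_cons ?_ (.block_cons ?_ (.seq (s' := t') ?_
          (.block_cons ?_ (.block_cons ?_ (.instr rfl ?_))))),
          ⟨ρ'', A'', ((gt.update_temp _ _).update_temp _ _).update_temp _ _, gJ⟩, ?_, ?_, ?_⟩
      · simp [Instr.cost]
      · simpa [Instr.cost, Instr.exec, i2] using hjL
      · simpa [Instr.exec, i2] using g
      · simp [Instr.cost, hone]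
      · simpa [Instr.cost, Instr.exec, g1, hone] using hjL
      · simpa [Instr.cost, Instr.exec, g0, hone] using hmj
      · simp [Instr.exec, g0]
        omega
      · simp [Instr.exec, g1]
      · intro l hl
        have hne : ∀ d, (l = k + d) = False := fun d => by simp; omega
        simp [Instr.exec, hne, e2, show l ≠ k by omega, gs l (by omega), i4 l hl])
    (s := update s₁ (3 * (k + 1) + 1) 0)
    ⟨⟨ρ, A, hs₁.update_temp _ _, h0⟩, by simp [hv], by simp, fun j hj => by
      rw [update_of_ne (by omega), ht j hj]⟩
  refine ⟨s₂, ρ₂, A₂,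
    (h₁.seq (.seq (c := 1) (.instr rfl (by simp [Instr.cost])) h₂)).mono ?_, i0, i1, i4⟩
  simp only [Polynomial.eval_add, Polynomial.eval_mul, Polynomial.eval_ofNat]
  have : m * m.size ≤ m * r.eval L := by gcongr
  nlinarith [Nat.zero_le (m * q.eval L), Nat.zero_le (m * c * q.eval L),
    Nat.zero_le (m * c * r.eval L), Nat.zero_le (m * c)]

/-! ### Branching walks -/

section Walks

variable {V : Type*} [Fintype V] [DecidableEq V]

/-- The vertex sets of the branching walks of weight `j` that start at `v` and only visit vertices
in `N`, each walk contributing one copy of its set. A branching walk is a rooted ordered tree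
together with a homomorphism into the digraph `E`; it is a single vertex, or it arises from a
branching walk at `v` by grafting, as last subtree of the root, a branching walk that starts at an
out-neighbour `u` of `v`. The weight counts vertices with multiplicity. -/
def walks (E : V → V → Bool) (N : V → Bool) (w : V → ℕ) (j : ℕ) (v : V) : Multiset (Finset V) :=
  (if j = w v ∧ N v then {{v}} else 0) +
    ∑ u, if E v u then ∑ i : Fin (j - 1), (walks E N w (i + 1) v).bind fun W =>
      (walks E N w (j - (i + 1)) u).map (W ∪ ·) else 0
termination_by j
decreasing_by all_goals omega

variable {E : V → V → Bool} {N : V → Bool} {w : V → ℕ}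

theorem walks_sound {j : ℕ} : ∀ {v : V} {W : Finset V}, W ∈ walks E N w j v →
    v ∈ W ∧ (∀ a ∈ W, N a) ∧ ∑ a ∈ W, w a ≤ j ∧
      ∀ a ∈ W, Relation.ReflTransGen (fun b c => E b c ∧ c ∈ W) v a := by
  induction j using Nat.strong_induction_on with
  | _ j ih =>
    intro v W hW
    rw [walks, Multiset.mem_add] at hW
    rcases hW with hW | hW
    · split_ifs at hW with h
      · obtain rfl := Multiset.mem_singleton.1 hW
        simp [h.1, h.2, Relation.ReflTransGen.refl]
      · simp at hW
    · obtain ⟨u, -, hu⟩ := Multiset.mem_sum.1 hW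
      split_ifs at hu with hE
      · obtain ⟨i, -, hi⟩ := Multiset.mem_sum.1 hu
        obtain ⟨W₁, h₁, h₂⟩ := Multiset.mem_bind.1 hi
        obtain ⟨W₂, h₃, rfl⟩ := Multiset.mem_map.1 h₂
        have hi := i.2
        obtain ⟨a1, a2, a3, a4⟩ := ih (i + 1) (by omega) h₁
        obtain ⟨b1, b2, b3, b4⟩ := ih (j - (i + 1)) (by omega) h₃
        refine ⟨mem_union_left _ a1, fun a ha => ?_, ?_, fun a ha => ?_⟩
        · exact (mem_union.1 ha).elim (a2 a) (b2 a)
        · have := sum_union_inter (s₁ := W₁) (s₂ := W₂) (f := w)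
          omega
        · rcases mem_union.1 ha with ha | ha
          · exact (a4 a ha).lift id fun b c h => ⟨h.1, mem_union_left _ h.2⟩
          · exact .head ⟨hE, mem_union_right _ b1⟩
              ((b4 a ha).lift id fun b c h => ⟨h.1, mem_union_right _ h.2⟩)
      · simp at hu

theorem singleton_mem_walks {v : V} (hv : N v) : {v} ∈ walks E N w (w v) v := by
  rw [walks, Multiset.mem_add]
  exact .inl (by simp [hv])

theorem union_mem_walks {i j : ℕ} {v u : V} {W₁ W₂ : Finset V} (hi : 0 < i) (hj : 0 < j)
    (hE : E v u) (h₁ : W₁ ∈ walks E N w i v) (h₂ : W₂ ∈ walks E N w j u) :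
    W₁ ∪ W₂ ∈ walks E N w (i + j) v := by
  rw [walks, Multiset.mem_add, Multiset.mem_sum]
  refine .inr ⟨u, mem_univ u, ?_⟩
  rw [if_pos hE, Multiset.mem_sum]
  refine ⟨⟨i - 1, by omega⟩, mem_univ _,
    Multiset.mem_bind.2 ⟨W₁, ?_, Multiset.mem_map.2 ⟨W₂, ?_, rfl⟩⟩⟩
  · rwa [show i - 1 + 1 = i by omega]
  · rwa [show i + j - (i - 1 + 1) = j by omega]

/-- A vertex can be appended to a branching walk below any of its vertices. -/
theorem insert_mem_walks (hw : ∀ a, 0 < w a) {a b : V} (hE : E a b) (hb : N b) {j : ℕ} :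
    ∀ {v : V} {W : Finset V}, W ∈ walks E N w j v → a ∈ W →
      insert b W ∈ walks E N w (j + w b) v := by
  induction j using Nat.strong_induction_on with
  | _ j ih =>
    intro v W hW ha
    have hW' := hW
    rw [walks, Multiset.mem_add] at hW
    rcases hW with hW | hW
    · split_ifs at hW with h
      · obtain rfl := Multiset.mem_singleton.1 hW
        obtain rfl := mem_singleton.1 ha
        rw [insert_eq, union_comm]
        exact union_mem_walks (h.1 ▸ hw a) (hw b) hE hW' (singleton_mem_walks hb)
      · simp at hW
    · obtain ⟨u, -, hu⟩ := Multiset.mem_sum.1 hW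
      split_ifs at hu with hE'
      · obtain ⟨i, -, hi⟩ := Multiset.mem_sum.1 hu
        obtain ⟨W₁, h₁, h₂⟩ := Multiset.mem_bind.1 hi
        obtain ⟨W₂, h₃, rfl⟩ := Multiset.mem_map.1 h₂
        have hi := i.2
        rcases mem_union.1 ha with ha | ha
        · have := union_mem_walks (by omega) (by omega) hE' (ih (i + 1) (by omega) h₁ ha) h₃
          rwa [insert_union, show (i : ℕ) + 1 + w b + (j - (i + 1)) = j + w b by omega] at this
        · have := union_mem_walks (by omega) (by omega) hE' h₁
            (ih (j - (i + 1)) (by omega) h₃ ha)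
          rwa [union_insert, show (i : ℕ) + 1 + (j - (i + 1) + w b) = j + w b by omega] at this
      · simp at hu

/-- The number of branching walks at `v` of weight `j` that avoid `X`. -/
def avoiding (E : V → V → Bool) (N : V → Bool) (w : V → ℕ) (X : Finset V) (j : ℕ) (v : V) : ℕ :=
  (walks E N w j v).countP (Disjoint X)

theorem countP_sum {ι α : Type*} (p : α → Prop) [DecidablePred p] (s : Finset ι)
    (f : ι → Multiset α) : (∑ i ∈ s, f i).countP p = ∑ i ∈ s, (f i).countP p :=
  map_sum (Multiset.countPAddMonoidHom p) f s

/-- The vertex sets of a branching walk and of one grafted onto it both have to avoid `X`, so the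
counts multiply. -/
theorem avoiding_eq (X : Finset V) (j : ℕ) (v : V) : avoiding E N w X j v =
    (if j = w v ∧ N v ∧ v ∉ X then 1 else 0) + ∑ u, (E v u).toNat *
      ∑ i ∈ range (j - 1), avoiding E N w X (i + 1) v * avoiding E N w X (j - (i + 1)) u := by
  have key : ∀ s t : Multiset (Finset V),
      (s.bind fun W => t.map (W ∪ ·)).countP (Disjoint X) =
        s.countP (Disjoint X) * t.countP (Disjoint X) := by
    intro s t
    induction s using Multiset.induction_on with
    | empty => simp
    | cons W s ih =>
      rw [Multiset.cons_bind, Multiset.countP_add, ih, Multiset.countP_cons, Multiset.countP_map]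
      by_cases h : Disjoint X W
      · simp [h, disjoint_union_right, Multiset.countP_eq_card_filter]
        ring
      · simp [h, disjoint_union_right]
  rw [avoiding, walks, Multiset.countP_add, countP_sum]
  congr 1
  · by_cases h : j = w v ∧ N v
    · by_cases hv : v ∈ X
      · simp [h, hv, ← Multiset.cons_zero]
      · simp [h, hv, ← Multiset.cons_zero]
    · rw [if_neg h, if_neg (by tauto)]
      simp
  · refine sum_congr rfl fun u _ => ?_
    cases E v u
    · simp
    · simp only [if_true, Bool.toNat_true, one_mul]
      rw [countP_sum, sum_range]
      exact sum_congr rfl fun i _ => key _ _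

/-- The counts grow only exponentially in the weight: the bound `K ^ (2 * j - 1)` leaves, for each
of the less than `K` ways to choose `u` and to split `j`, one factor `K` to spare. -/
theorem avoiding_le (X : Finset V) {K D : ℕ} (hK : Fintype.card V * D + 1 ≤ K) {j : ℕ} :
    j ≤ D → ∀ v, avoiding E N w X j v ≤ K ^ (2 * j - 1) := by
  induction j using Nat.strong_induction_on with
  | _ j ih =>
    intro hj v
    rw [avoiding_eq]
    have h1 : ∑ u, (E v u).toNat * ∑ i ∈ range (j - 1), avoiding E N w X (i + 1) v *
        avoiding E N w X (j - (i + 1)) u ≤ ∑ u : V, ∑ i ∈ range (j - 1), K ^ (2 * j - 2) := by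
      refine sum_le_sum fun u _ =>
        (Nat.mul_le_mul_right _ (Bool.toNat_le _)).trans ?_
      rw [one_mul]
      refine sum_le_sum fun i hi => ?_
      have hi := mem_range.1 hi
      rw [show 2 * j - 2 = (2 * (i + 1) - 1) + (2 * (j - (i + 1)) - 1) by omega, pow_add]
      exact Nat.mul_le_mul (ih _ (by omega) (by omega) v) (ih _ (by omega) (by omega) u)
    have h2 : (if j = w v ∧ N v ∧ v ∉ X then 1 else 0) ≤ 1 := by split_ifs <;> simp
    rcases Nat.eq_zero_or_pos j with rfl | hj0
    · simpa using h2
    simp only [sum_const, card_univ, card_range, smul_eq_mul] at h1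
    have hK0 : 1 ≤ K ^ (2 * j - 2) := Nat.one_le_pow _ _ (by omega)
    have h3 : Fintype.card V * (j - 1) + 1 ≤ K := le_trans (by gcongr; omega) hK
    calc _ ≤ 1 + Fintype.card V * ((j - 1) * K ^ (2 * j - 2)) := Nat.add_le_add h2 h1
      _ ≤ (Fintype.card V * (j - 1) + 1) * K ^ (2 * j - 2) := by rw [add_mul, mul_assoc]; omega
      _ ≤ K * K ^ (2 * j - 2) := by gcongr
      _ = K ^ (2 * j - 1) := by rw [← pow_succ', show 2 * j - 2 + 1 = 2 * j - 1 by omega]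

/-- Inclusion–exclusion: among the branching walks, those that visit all of `S`. -/
theorem sum_powerset_avoiding (S : Finset V) (j : ℕ) (v : V) :
    ∑ X ∈ S.powerset, (-1 : ℤ) ^ #X * avoiding E N w X j v =
      (walks E N w j v).countP (S ⊆ ·) := by
  have key : ∀ s : Multiset (Finset V),
      ∑ X ∈ S.powerset, (-1 : ℤ) ^ #X * s.countP (Disjoint X) = s.countP (S ⊆ ·) := by
    intro s
    induction s using Multiset.induction_on with
    | empty => simp
    | cons W s ih =>
      simp only [Multiset.countP_cons, Nat.cast_add, mul_add, sum_add_distrib, ih]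
      congr 1
      have h1 : ∑ X ∈ S.powerset, (-1 : ℤ) ^ #X * ((if Disjoint X W then 1 else 0 : ℕ) : ℤ) =
          ∑ X ∈ (S \ W).powerset, (-1 : ℤ) ^ #X := by
        simp only [Nat.cast_ite, Nat.cast_one, Nat.cast_zero, mul_ite, mul_one, mul_zero,
          ← sum_filter]
        refine sum_congr ?_ fun _ _ => rfl
        ext X
        simp [subset_sdiff]
      rw [h1, sum_powerset_neg_one_pow_card]
      simp [sdiff_eq_empty_iff_subset]
  exact key _

end Walks

/-! ### Numbering the subsets of a set -/

/-- The number of elements of `S` below `a`. -/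
def rank {n : ℕ} (S : Finset (Fin n)) (a : Fin n) : ℕ := #{b ∈ S | b < a}

/-- The subset of `S` whose characteristic word is the binary expansion of `y`. -/
def subsetOf {n : ℕ} (S : Finset (Fin n)) (y : ℕ) : Finset (Fin n) := {a ∈ S | y.testBit (rank S a)}

/-- The numbers below `2 ^ #S` enumerate the subsets of `S`: the ranks of the elements of `S` are
exactly the positions below `#S`. -/
theorem sum_range_subsetOf {n : ℕ} (S : Finset (Fin n)) {M : Type*} [AddCommMonoid M]
    (g : Finset (Fin n) → M) : ∑ y ∈ range (2 ^ #S), g (subsetOf S y) = ∑ X ∈ S.powerset, g X := by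
  have hlt : ∀ a ∈ S, rank S a < #S := fun a ha =>
    card_lt_card (filter_ssubset.2 ⟨a, ha, lt_irrefl a⟩)
  have hrank : ∀ a ∈ S, ∀ b ∈ S, rank S a = rank S b → a = b := by
    have : ∀ a ∈ S, ∀ b, a < b → rank S a < rank S b := fun a ha b hab => by
      refine card_lt_card ⟨fun c hc => ?_, fun h => ?_⟩
      · simp only [mem_filter] at hc ⊢
        exact ⟨hc.1, hc.2.trans hab⟩
      · simpa using h (mem_filter.2 ⟨ha, hab⟩)
    intro a ha b hb h
    rcases lt_trichotomy a b with hab | hab | hab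
    · exact absurd h (this a ha b hab).ne
    · exact hab
    · exact absurd h (this b hb a hab).ne'
  have himg : S.image (rank S) = range #S := by
    refine eq_of_subset_of_card_le (fun i hi => ?_) ?_
    · obtain ⟨a, ha, rfl⟩ := mem_image.1 hi
      exact mem_range.2 (hlt a ha)
    · rw [card_range, card_image_of_injOn fun a ha b hb h => hrank a ha b hb h]
  have hinj : Set.InjOn (subsetOf S) (range (2 ^ #S)) := by
    intro y hy z hz h
    refine Nat.eq_of_testBit_eq fun i => ?_
    by_cases hi : i < #S
    · obtain ⟨a, ha, rfl⟩ := mem_image.1 (himg ▸ mem_range.2 hi)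
      have := congrArg (a ∈ ·) h
      simp only [subsetOf, mem_filter, ha, true_and, eq_iff_iff] at this
      exact Bool.eq_iff_iff.2 this
    · have hp : 2 ^ #S ≤ 2 ^ i := Nat.pow_le_pow_right two_pos (by omega)
      rw [Nat.testBit_lt_two_pow ((mem_range.1 (mem_coe.1 hy)).trans_le hp),
        Nat.testBit_lt_two_pow ((mem_range.1 (mem_coe.1 hz)).trans_le hp)]
  rw [← sum_image hinj]
  congr 1
  refine eq_of_subset_of_card_le (fun X hX => ?_) ?_
  · obtain ⟨y, -, rfl⟩ := mem_image.1 hX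
    exact mem_powerset.2 (filter_subset _ _)
  · rw [card_image_of_injOn hinj, card_powerset, card_range]

/-! ### Yes-instances and branching walks -/

namespace GCAIInstance

variable (I : GCAIInstance)

/-- The number of individuals that may be added. -/
def budget : ℕ := min I.k.natAbs I.n

/-- Every individual weighs `1`, and one outside `T` weighs `n` more, so that a nonempty set of
individuals has weight at most `n * (budget + 1)` if and only if at most `budget` of them are
outside `T`. -/
def weight (a : Fin I.n) : ℕ := 1 + I.n * (1 - (decide (a ∈ I.T)).toNat)

theorem weight_pos (a : Fin I.n) : 0 < I.weight a := by
  unfold weight; omega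

theorem sum_weight (W : Finset (Fin I.n)) : ∑ a ∈ W, I.weight a = #W + I.n * #(W \ I.T) := by
  simp only [weight, sum_add_distrib, ← mul_sum, sum_const, smul_eq_mul, mul_one]
  congr 2
  rw [← filter_notMem_eq_sdiff, card_filter]
  exact sum_congr rfl fun a _ => by by_cases h : a ∈ I.T <;> simp [h]

/-- Whoever can be reached inside `T` from a member of the first stage is selected. -/
theorem mem_csr_of_reach {N : Type} {φ : Profile N} {T : Set N} {r : N} (hr : r ∈ T)
    (h : ∀ b ∈ T, φ b r = true) {a : N}
    (ha : Relation.ReflTransGen (fun b c => φ b c = true ∧ c ∈ T) r a) :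
    a ∈ csr.select N φ T := by
  induction ha with
  | refl => exact Set.mem_iUnion.2 ⟨0, hr, h⟩
  | tail _ hbc ih =>
    obtain ⟨m, hm⟩ := Set.mem_iUnion.1 ih
    exact Set.mem_iUnion.2 ⟨m + 1, .inr ⟨hbc.2, _, hm, hbc.1⟩⟩

/-- The rule selects all of `S` once somebody who is qualified by everybody leads to all of `S`;
whom the walk visits outside `T` has to be added. Conversely, among the vertex sets of branching
walks inside `T ∪ U` whose weight counts no vertex twice, one of maximal size contains everybody
who is selected. -/
theorem yes_iff : I.Yes csr ↔ 0 ≤ I.k ∧ ∃ r : Fin I.n, (∀ a ∈ I.T, I.φ a r = true) ∧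
    ∃ j < I.n * (I.budget + 1) + 1,
      ∃ W ∈ walks I.φ (fun a => I.φ a r) I.weight j r, I.S ⊆ W := by
  constructor
  · rintro ⟨U, hUT, hUk, hS⟩
    have hk : 0 ≤ I.k := (Int.natCast_nonneg _).trans hUk
    refine ⟨hk, ?_⟩
    obtain ⟨s₀, hs₀⟩ := I.S_nonempty
    obtain ⟨m₀, hm₀⟩ := Set.mem_iUnion.1 (hS hs₀)
    -- the first stage is nonempty
    obtain ⟨r, hrT, hr⟩ : ∃ r, r ∈ csrStage I.φ ((I.T : Set (Fin I.n)) ∪ U) 0 := by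
      by_contra! h
      have : ∀ m, csrStage I.φ ((I.T : Set (Fin I.n)) ∪ U) m = ∅ := by
        intro m
        induction m with
        | zero => exact Set.eq_empty_of_forall_notMem h
        | succ m ih => simp [csrStage, ih]
      rw [this] at hm₀
      exact hm₀
    have hr' : ∀ b ∈ I.T ∪ U, I.φ b r = true := fun b hb => hr b (by simpa using hb)
    have hrTU : r ∈ I.T ∪ U := by simpa using hrT
    refine ⟨r, fun a ha => hr a (.inl ha), ?_⟩
    -- the vertex sets of branching walks that visit nobody twice
    let F : Finset (Finset (Fin I.n)) := {W ∈ (I.T ∪ U).powerset |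
      r ∈ W ∧ W ∈ walks I.φ (fun a => I.φ a r) I.weight (∑ a ∈ W, I.weight a) r}
    have hF : F.Nonempty := ⟨{r}, by
      simp only [F, mem_filter, mem_powerset, singleton_subset_iff, mem_singleton, true_and,
        sum_singleton]
      exact ⟨hrTU, singleton_mem_walks (hr' r hrTU)⟩⟩
    obtain ⟨W, hWF, hmax⟩ := exists_max_image F card hF
    simp only [F, mem_filter, mem_powerset] at hWF hmax
    obtain ⟨hW, hrW, hWw⟩ := hWF
    have hclosed : ∀ a ∈ W, ∀ b ∈ I.T ∪ U, I.φ a b = true → b ∈ W := by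
      intro a ha b hb hab
      by_contra hbW
      have h := hmax (insert b W) ⟨insert_subset hb hW, mem_insert_of_mem hrW, by
        rw [sum_insert hbW, add_comm]
        exact insert_mem_walks I.weight_pos hab (hr' b hb) hWw ha⟩
      rw [card_insert_of_notMem hbW] at h
      omega
    have hstage : ∀ m, csrStage I.φ ((I.T : Set (Fin I.n)) ∪ U) m ⊆ W := by
      intro m
      induction m with
      | zero => exact fun a ha => hclosed r hrW a (by simpa using ha.1) (ha.2 r hrT)
      | succ m ih =>
        rintro a (ha | ⟨ha, b, hb, hba⟩)
        · exact ih ha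
        · exact hclosed b (ih hb) a (by simpa using ha) hba
    refine ⟨_, ?_, W, hWw, fun s hs => ?_⟩
    · have h1 : #(W \ I.T) ≤ I.budget := by
        have h2 : #(W \ I.T) ≤ #U := card_le_card fun a ha => by
          have := hW (mem_sdiff.1 ha).1
          simpa [(mem_sdiff.1 ha).2] using this
        have h3 := card_le_univ U
        rw [Fintype.card_fin] at h3
        unfold budget
        omega
      have h4 := card_le_univ W
      rw [Fintype.card_fin] at h4
      rw [sum_weight, mul_add]
      have := Nat.mul_le_mul_left I.n h1
      omega
    · obtain ⟨m, hm⟩ := Set.mem_iUnion.1 (hS hs)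
      exact hstage m hm
  · rintro ⟨hk, r, hrT, j, hj, W, hW, hSW⟩
    obtain ⟨hrW, hWr, hWw, hreach⟩ := walks_sound hW
    have hTW : (I.T : Set (Fin I.n)) ∪ ((W \ I.T : Finset (Fin I.n)) : Set (Fin I.n)) =
        (I.T : Set (Fin I.n)) ∪ (W : Set (Fin I.n)) := by
      rw [coe_sdiff, Set.union_sdiff_self]
    refine ⟨W \ I.T, disjoint_sdiff_self_left, ?_, ?_⟩
    · rw [sum_weight] at hWw
      have h1 : 0 < #W := card_pos.2 ⟨r, hrW⟩
      have h2 : I.n * #(W \ I.T) < I.n * (I.budget + 1) := by omega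
      have h3 := Nat.lt_of_mul_lt_mul_left h2
      have : I.budget ≤ I.k.natAbs := min_le_left _ _
      omega
    · rw [hTW]
      refine fun s hs => mem_csr_of_reach (.inr hrW) ?_
        ((hreach s (hSW hs)).lift id fun b c h => ⟨h.1, .inr h.2⟩)
      rintro b (hb | hb)
      · exact hrT b hb
      · exact hWr b hb

end GCAIInstance

namespace GCAIInstance

variable (I : GCAIInstance)

/-! ### The signed count -/

/-- The number of branching walks at `r` of weight at most `n * (budget + 1)` that avoid `X` and
only visit individuals who qualify `r`. -/
def count (X : Finset (Fin I.n)) (r : Fin I.n) : ℕ :=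
  ∑ j ∈ range (I.n * (I.budget + 1) + 1),
    avoiding I.φ (fun a => I.φ a r) I.weight X j r

/-- Whether `r` may be the individual whom everybody qualifies: all of `T` qualify `r` (and no
individual at all is admitted for negative `k`). -/
def good (r : Fin I.n) : ℕ := if 0 ≤ I.k ∧ ∀ a ∈ I.T, I.φ a r = true then 1 else 0

/-- The difference of the two sides is the number of branching walks at admissible roots that visit
all of `S`. -/
theorem yes_iff_lt : I.Yes csr ↔
    ∑ X ∈ I.S.powerset, ∑ r, I.good r * (#X % 2) * I.count X r <
      ∑ X ∈ I.S.powerset, ∑ r, I.good r * (1 - #X % 2) * I.count X r := by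
  rw [← Nat.cast_lt (α := ℤ), ← sub_pos, Nat.cast_sum, Nat.cast_sum, ← sum_sub_distrib]
  have h : ∀ X : Finset (Fin I.n),
      ((∑ r, I.good r * (1 - #X % 2) * I.count X r : ℕ) : ℤ) -
        ((∑ r, I.good r * (#X % 2) * I.count X r : ℕ) : ℤ) =
      ∑ r, ∑ j ∈ range (I.n * (I.budget + 1) + 1), (I.good r : ℤ) * ((-1) ^ #X *
        avoiding I.φ (fun a => I.φ a r) I.weight X j r) := by
    intro X
    rw [Nat.cast_sum, Nat.cast_sum, ← sum_sub_distrib]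
    refine sum_congr rfl fun r _ => ?_
    rw [← mul_sum, ← mul_sum, count]
    rcases Nat.even_or_odd #X with h | h
    · rw [Nat.even_iff.1 h, h.neg_one_pow]
      simp
    · rw [Nat.odd_iff.1 h, h.neg_one_pow]
      simp
  have h' : ∀ r : Fin I.n, ∑ X ∈ I.S.powerset, ∑ j ∈ range (I.n * (I.budget + 1) + 1),
      (I.good r : ℤ) * ((-1) ^ #X * avoiding I.φ (fun a => I.φ a r) I.weight X j r) =
      ((I.good r * ∑ j ∈ range (I.n * (I.budget + 1) + 1),
        (walks I.φ (fun a => I.φ a r) I.weight j r).countP (I.S ⊆ ·) : ℕ) : ℤ) := by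
    intro r
    rw [sum_comm]
    push_cast
    rw [mul_sum]
    refine sum_congr rfl fun j _ => ?_
    rw [← mul_sum, sum_powerset_avoiding]
  rw [sum_congr rfl fun X _ => h X, sum_comm, sum_congr rfl fun r _ => h' r, ← Nat.cast_sum,
    Nat.cast_pos, Finset.sum_pos_iff, yes_iff]
  constructor
  · rintro ⟨hk, r, hr, j, hj, W, hW, hS⟩
    refine ⟨r, mem_univ r, ?_⟩
    rw [good, if_pos ⟨hk, hr⟩, one_mul]
    exact sum_pos_iff.2 ⟨j, mem_range.2 hj, Multiset.countP_pos.2 ⟨W, hW, hS⟩⟩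
  · rintro ⟨r, -, hr⟩
    by_cases hg : 0 ≤ I.k ∧ ∀ a ∈ I.T, I.φ a r = true
    · rw [good, if_pos hg, one_mul] at hr
      obtain ⟨j, hj, hj'⟩ := sum_pos_iff.1 hr
      obtain ⟨W, hW, hS⟩ := Multiset.countP_pos.1 hj'
      exact ⟨hg.1, r, hg.2, j, mem_range.1 hj, W, hW, hS⟩
    · simp [good, hg] at hr

/-! ### Reading the input word -/

theorem n_pos : 0 < I.n := by
  obtain ⟨a, -⟩ := I.S_nonempty
  exact a.pos

theorem getD_map_finRange {n : ℕ} (f : Fin n → Bool) (a : Fin n) :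
    ((List.finRange n).map f).getD a false = f a := by
  simp [List.getD_eq_getElem?_getD]

theorem length_flatMap {α β : Type*} {n : ℕ} (l : List α) (f : α → List β)
    (hf : ∀ a, (f a).length = n) : (l.flatMap f).length = l.length * n := by
  induction l with
  | nil => simp
  | cons a l ih => simp [hf, ih, add_mul, add_comm]

theorem getD_flatMap {α β : Type*} {n : ℕ} (f : α → List β) (hf : ∀ a, (f a).length = n) (d : β)
    {j : ℕ} (hj : j < n) : ∀ (l : List α) (i : ℕ) (hi : i < l.length),
      (l.flatMap f).getD (i * n + j) d = (f l[i]).getD j d := by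
  intro l
  induction l with
  | nil => intro i hi; simp at hi
  | cons a l ih =>
    intro i hi
    rw [List.flatMap_cons]
    rcases i with _ | i
    · rw [List.getD_append _ _ _ _ (by simpa [hf] using hj)]
      simp
    · rw [List.getD_append_right _ _ _ _ (by rw [hf, add_mul]; omega), hf,
        show (i + 1) * n + j - n = i * n + j by rw [add_mul]; omega,
        ih i (by simpa using hi)]
      simp

theorem length_encode : I.encode.length =
    I.n + 1 + I.n * I.n + I.n + I.n + 1 + I.k.natAbs.bits.length := by
  simp [encode, length_flatMap (n := I.n)]
  omega

theorem encode_lt {i : ℕ} (h : i < I.n) : I.encode.getD i false = true := by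
  simp only [encode, List.append_assoc]
  rw [List.getD_append _ _ _ _ (by simpa using h)]
  simp [List.getD_eq_getElem?_getD, h]

theorem encode_n : I.encode.getD I.n false = false := by
  simp only [encode, List.append_assoc]
  rw [List.getD_append_right _ _ _ _ (by simp)]
  simp

theorem getD_append_add {α : Type*} {l l' : List α} {d : α} {n : ℕ} (h : l.length = n) (i : ℕ) :
    (l ++ l').getD (n + i) d = l'.getD i d := by
  rw [List.getD_append_right _ _ _ _ (by omega), h, Nat.add_sub_cancel_left]

theorem encode_profile (a b : Fin I.n) :
    I.encode.getD (I.n + 1 + (a * I.n + b)) false = I.φ a b := by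
  have hl : (a : ℕ) * I.n + b < I.n * I.n := by nlinarith [a.2, b.2]
  simp only [encode, List.append_assoc]
  rw [← List.append_assoc, getD_append_add (by simp),
    List.getD_append _ _ _ _ (by simpa [length_flatMap (n := I.n)] using hl),
    getD_flatMap _ (by simp) _ b.2 _ _ (by simp), getD_map_finRange]
  simp

theorem encode_distinguished (a : Fin I.n) :
    I.encode.getD (I.n + 1 + I.n * I.n + a) false = decide (a ∈ I.S) := by
  rw [encode, List.append_assoc, List.append_assoc, List.append_assoc,
    getD_append_add (by simp [length_flatMap (n := I.n)]; omega),
    List.getD_append _ _ _ _ (by simp), getD_map_finRange]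

theorem encode_team (a : Fin I.n) :
    I.encode.getD (I.n + 1 + I.n * I.n + I.n + a) false = decide (a ∈ I.T) := by
  rw [encode, List.append_assoc, List.append_assoc,
    getD_append_add (by simp [length_flatMap (n := I.n)]; omega),
    List.getD_append _ _ _ _ (by simp), getD_map_finRange]

theorem encode_sign :
    I.encode.getD (I.n + 1 + I.n * I.n + I.n + I.n) false = decide (I.k < 0) := by
  rw [encode, List.append_assoc, ← Nat.add_zero (I.n + 1 + I.n * I.n + I.n + I.n),
    getD_append_add (by simp [length_flatMap (n := I.n)]; omega)]
  rfl

theorem encode_bits (i : ℕ) :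
    I.encode.getD (I.n + 1 + I.n * I.n + I.n + I.n + 1 + i) false = I.k.natAbs.testBit i := by
  rw [encode, getD_append_add (by simp [length_flatMap (n := I.n)]; omega), Nat.testBit_eq_inth]
  rfl

end GCAIInstance

/-! ### The expressions of the program

Variable `0` is the answer, `1` and `2` are the counts for the sets `X` of even and of odd size,
`3` is the round, which numbers the pairs of a set `X` and a root, and `4` is the position in the
table. The variables from `5` on are bound by sums and products. -/

namespace Exp

instance (n : ℕ) : OfNat Exp n := ⟨.lit n⟩
instance : Add Exp := ⟨.bin .add⟩
instance : Sub Exp := ⟨.bin .sub⟩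
instance : Mul Exp := ⟨.bin .mul⟩
instance : Div Exp := ⟨.bin .div⟩

/-- The sum of the values of `e` at `i = 0, …, b - 1`, with at most `|x|` terms. -/
def sum (i : ℕ) (b e : Exp) : Exp := .big .add 0 i b e

/-- The product of the values of `e` at `i = 0, …, b - 1`, with at most `|x|` factors. -/
def prod (i : ℕ) (b e : Exp) : Exp := .big .mul 1 i b e

/-- The remainder of `e` modulo `f`. -/
def mod (e f : Exp) : Exp := e - f * (e / f)

/-- `1` if `e` and `f` have the same value, and `0` otherwise. -/
def eq (e f : Exp) : Exp := 1 - ((e - f) + (f - e))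

variable (x : List Bool) (ρ A : ℕ → ℕ) (e f : Exp)

@[simp] theorem eval_ofNat (n : ℕ) : eval x ofNat(n) ρ A = OfNat.ofNat n := rfl
@[simp] theorem eval_var (i : ℕ) : eval x (.var i) ρ A = ρ i := rfl
@[simp] theorem eval_len : eval x .len ρ A = x.length := rfl
@[simp] theorem eval_arr : eval x (.arr e) ρ A = A (e.eval x ρ A) := rfl
@[simp] theorem eval_inp : eval x (.inp e) ρ A = (x.getD (e.eval x ρ A) false).toNat := rfl
@[simp] theorem eval_add : eval x (e + f) ρ A = e.eval x ρ A + f.eval x ρ A := rfl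
@[simp] theorem eval_sub : eval x (e - f) ρ A = e.eval x ρ A - f.eval x ρ A := rfl
@[simp] theorem eval_mul : eval x (e * f) ρ A = e.eval x ρ A * f.eval x ρ A := rfl
@[simp] theorem eval_div : eval x (e / f) ρ A = e.eval x ρ A / f.eval x ρ A := rfl

@[simp] theorem eval_mod : eval x (e.mod f) ρ A = e.eval x ρ A % f.eval x ρ A := by
  simp [mod, Nat.mod_eq_sub_mul_div]

@[simp] theorem eval_eq :
    eval x (e.eq f) ρ A = if e.eval x ρ A = f.eval x ρ A then 1 else 0 := by
  simp only [eq, eval_sub, eval_add, eval_ofNat]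
  split_ifs <;> omega

variable {x ρ A e}

theorem eval_sum {m : ℕ} (i : ℕ) {b : Exp} (hb : b.eval x ρ A = m) (hm : m ≤ x.length) :
    eval x (sum i b e) ρ A = ∑ j ∈ range m, e.eval x (update ρ i j) A := by
  rw [sum, eval, Op.fold_add, hb, min_eq_left hm]

theorem eval_prod {m : ℕ} (i : ℕ) {b : Exp} (hb : b.eval x ρ A = m) (hm : m ≤ x.length) :
    eval x (prod i b e) ρ A = ∏ j ∈ range m, e.eval x (update ρ i j) A := by
  rw [prod, eval, Op.fold_mul, hb, min_eq_left hm]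

/-- The number `n` of individuals, computed as the length of the initial run of ones. -/
def size : Exp := sum 5 .len (prod 6 (.var 5 + 1) (.inp (.var 6)))

/-- Whether `a` qualifies `b`. -/
def profile (a b : Exp) : Exp := .inp (size + 1 + (a * size + b))

/-- Whether `a` is distinguished. -/
def distinguished (a : Exp) : Exp := .inp (size + 1 + size * size + a)

/-- Whether `a` belongs to `T`. -/
def team (a : Exp) : Exp := .inp (size + 1 + size * size + size + a)

/-- Whether `k` is negative. -/
def sign : Exp := .inp (size + 1 + size * size + size + size)

/-- The absolute value of `k`. -/
def absolute : Exp := sum 5 .len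
  (prod 6 (.var 5) 2 * .inp (size + 1 + size * size + size + size + 1 + .var 5))

/-- `min |k| n` -/
def budget : Exp := size - (size - absolute)

/-- The number of weights that occur in the table. -/
def levels : Exp := size * (budget + 1) + 1

/-- `2 ^ ℓ` -/
def subsets : Exp := prod 7 size (1 + distinguished (.var 7))

/-- The number of the current set `X`. -/
def mask : Exp := .var 3 / size

/-- The current root `r`. -/
def root : Exp := (Exp.var 3).mod size

/-- Whether `a` belongs to the current set `X`. The product is `2` to the rank of `a` in `S`, so this
reads the binary digit of `mask` that belongs to `a`. -/
def excluded (a : Exp) : Exp :=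
  distinguished a * (mask / prod 8 a (1 + distinguished (.var 8))).mod 2

/-- The weight of `a`. -/
def weight (a : Exp) : Exp := 1 + size * (1 - team a)

/-- The weight of the current entry of the table. -/
def row : Exp := .var 4 / size

/-- The vertex of the current entry of the table. -/
def col : Exp := (Exp.var 4).mod size

/-- The current entry of the table, computed from earlier ones by the recursion `avoiding_eq`. Both
weights `i + 1` and `j - (i + 1)` that occur in it are less than `j`, so entries left over from an
earlier round are never read. -/
def entry : Exp := row.eq (weight col) * profile col root * (1 - excluded col) +
  sum 10 size (profile col (.var 10) * sum 11 (row - 1)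
    (.arr ((.var 11 + 1) * size + col) * .arr ((row - (.var 11 + 1)) * size + .var 10)))

/-- Whether the current root is qualified by all of `T`, and `k` is not negative. -/
def good : Exp :=
  (1 - sign) * prod 7 size (1 - team (.var 7) * (1 - profile (.var 7) root))

/-- The number of branching walks at the current root that avoid the current set. -/
def count : Exp := sum 9 levels (.arr (.var 9 * size + root))

/-- The parity of the size of the current set `X`. -/
def parity : Exp := (sum 7 size (excluded (.var 7))).mod 2

end Exp

namespace GCAIInstance

variable (I : GCAIInstance) (ρ A : ℕ → ℕ)

open Exp

@[simp] theorem eval_size : size.eval I.encode ρ A = I.n := by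
  rw [size, eval_sum 5 rfl (by exact le_rfl), eval_len]
  have hlen := I.length_encode
  have h : ∀ i ∈ range I.encode.length,
      (prod 6 (.var 5 + 1) (.inp (.var 6))).eval I.encode (update ρ 5 i) A =
        if i < I.n then 1 else 0 := by
    intro i hi
    rw [eval_prod (m := i + 1) 6 (by simp) (mem_range.1 hi)]
    split_ifs with h
    · refine prod_eq_one fun j hj => ?_
      have := mem_range.1 hj
      simp only [eval_inp, eval_var, update_self]
      rw [I.encode_lt (by omega)]
      rfl
    · refine prod_eq_zero (i := I.n) (mem_range.2 (by omega)) ?_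
      simp only [eval_inp, eval_var, update_self]
      rw [I.encode_n]
      rfl
  rw [sum_congr rfl h, ← card_filter]
  have : {i ∈ range I.encode.length | i < I.n} = range I.n := by
    ext i; simp; omega
  rw [this, card_range]

theorem n_le_length : I.n ≤ I.encode.length := by
  rw [length_encode]; omega

theorem eval_sum_size (i : ℕ) (e : Exp) : (Exp.sum i size e).eval I.encode ρ A =
    ∑ a : Fin I.n, e.eval I.encode (update ρ i a) A := by
  rw [eval_sum i (I.eval_size ρ A) I.n_le_length, sum_range]

theorem eval_prod_size (i : ℕ) (e : Exp) : (Exp.prod i size e).eval I.encode ρ A =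
    ∏ a : Fin I.n, e.eval I.encode (update ρ i a) A := by
  rw [eval_prod i (I.eval_size ρ A) I.n_le_length, prod_range]

variable {ρ A}

theorem eval_profile {e f : Exp} {a b : Fin I.n} (he : e.eval I.encode ρ A = a)
    (hf : f.eval I.encode ρ A = b) :
    (profile e f).eval I.encode ρ A = (I.φ a b).toNat := by
  simp only [profile, eval_inp, eval_add, eval_mul, eval_size, eval_ofNat, he, hf]
  rw [encode_profile]

theorem eval_distinguished {e : Exp} {a : Fin I.n} (he : e.eval I.encode ρ A = a) :
    (distinguished e).eval I.encode ρ A = (decide (a ∈ I.S)).toNat := by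
  simp only [distinguished, eval_inp, eval_add, eval_mul, eval_size, eval_ofNat, he]
  rw [encode_distinguished]

theorem eval_team {e : Exp} {a : Fin I.n} (he : e.eval I.encode ρ A = a) :
    (team e).eval I.encode ρ A = (decide (a ∈ I.T)).toNat := by
  simp only [team, eval_inp, eval_add, eval_mul, eval_size, eval_ofNat, he]
  rw [encode_team]

theorem eval_weight {e : Exp} {a : Fin I.n} (he : e.eval I.encode ρ A = a) :
    (Exp.weight e).eval I.encode ρ A = I.weight a := by
  simp [Exp.weight, weight, I.eval_team he]

variable (ρ A)

theorem eval_sign : sign.eval I.encode ρ A = (decide (I.k < 0)).toNat := by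
  simp only [sign, eval_inp, eval_add, eval_mul, eval_size, eval_ofNat]
  rw [encode_sign]

theorem sum_testBit (z : ℕ) (m : ℕ) :
    ∑ i ∈ range m, 2 ^ i * (z.testBit i).toNat = z % 2 ^ m := by
  induction m with
  | zero => simp [Nat.mod_one]
  | succ m ih => rw [sum_range_succ, ih, Nat.toNat_testBit, Nat.mod_pow_succ]

theorem eval_absolute : absolute.eval I.encode ρ A = I.k.natAbs := by
  rw [absolute, eval_sum 5 rfl (by exact le_rfl), eval_len]
  have h : ∀ i ∈ range I.encode.length,
      (prod 6 (.var 5) 2 * .inp (size + 1 + size * size + size + size + 1 + .var 5) : Exp).eval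
        I.encode (update ρ 5 i) A = 2 ^ i * (I.k.natAbs.testBit i).toNat := by
    intro i hi
    rw [eval_mul, eval_prod (m := i) 6 (by simp) (mem_range.1 hi).le]
    simp only [eval_inp, eval_add, eval_mul, eval_size, eval_ofNat, eval_var, update_self]
    rw [encode_bits]
    simp
  rw [sum_congr rfl h, sum_testBit, Nat.mod_eq_of_lt]
  refine (Nat.lt_size_self _).trans_le (Nat.pow_le_pow_right two_pos ?_)
  rw [length_encode, ← Nat.size_eq_bits_len]
  omega

@[simp] theorem eval_budget : Exp.budget.eval I.encode ρ A = I.budget := by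
  simp only [Exp.budget, eval_sub, eval_size, eval_absolute, budget]
  omega

@[simp] theorem eval_levels : levels.eval I.encode ρ A = I.n * (I.budget + 1) + 1 := by
  simp [levels]

theorem eval_subsets : subsets.eval I.encode ρ A = 2 ^ #I.S := by
  rw [subsets, eval_prod_size]
  have : ∀ a : Fin I.n, (1 + distinguished (.var 7) : Exp).eval I.encode (update ρ 7 a) A =
      if a ∈ I.S then 2 else 1 := by
    intro a
    rw [eval_add, I.eval_distinguished (a := a) (by simp)]
    by_cases h : a ∈ I.S <;> simp [h]
  simp [this]

theorem eval_excluded {e : Exp} {a : Fin I.n} (he : e.eval I.encode ρ A = a) :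
    (excluded e).eval I.encode ρ A = (decide (a ∈ subsetOf I.S (ρ 3 / I.n))).toNat := by
  have h : (prod 8 e (1 + distinguished (.var 8))).eval I.encode ρ A = 2 ^ rank I.S a := by
    rw [eval_prod 8 he (a.2.le.trans I.n_le_length)]
    have hr : range a = (univ.filter (· < a)).map Fin.valEmbedding := by
      ext i
      simp only [mem_range, mem_map, mem_filter, mem_univ, true_and, Fin.valEmbedding_apply]
      exact ⟨fun h => ⟨⟨i, h.trans a.2⟩, h, rfl⟩, fun ⟨b, hb, h⟩ => h ▸ hb⟩
    rw [hr, prod_map]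
    have : ∀ b ∈ univ.filter (· < a), (1 + distinguished (.var 8) : Exp).eval I.encode
        (update ρ 8 (Fin.valEmbedding b)) A = if b ∈ I.S then 2 else 1 := by
      intro b _
      rw [eval_add, I.eval_distinguished (a := b) (by simp)]
      by_cases h : b ∈ I.S <;> simp [h]
    rw [prod_congr rfl this, prod_ite, prod_const, prod_const_one, mul_one, rank]
    congr 2
    ext b
    simp [and_comm]
  rw [excluded, eval_mul, eval_mod, eval_div, h, I.eval_distinguished he]
  simp only [mask, eval_div, eval_var, eval_size, eval_ofNat, subsetOf, mem_filter,
    Nat.testBit_eq_decide_div_mod_eq, decide_eq_true_eq]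
  by_cases h : a ∈ I.S
  · have : ρ 3 / I.n / 2 ^ rank I.S a % 2 < 2 := Nat.mod_lt _ two_pos
    interval_cases ρ 3 / I.n / 2 ^ rank I.S a % 2 <;> simp [h]
  · simp [h]

theorem eval_parity : parity.eval I.encode ρ A = #(subsetOf I.S (ρ 3 / I.n)) % 2 := by
  rw [parity, eval_mod, eval_sum_size]
  have : ∀ a : Fin I.n, (excluded (.var 7)).eval I.encode (update ρ 7 a) A =
      if a ∈ subsetOf I.S (ρ 3 / I.n) then 1 else 0 := by
    intro a
    rw [I.eval_excluded _ _ (a := a) (by simp)]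
    by_cases h : a ∈ subsetOf I.S (ρ 3 / I.n) <;> simp [h]
  simp [this]

/-- Position `i` of the table, read as a vertex. -/
def vertex (i : ℕ) : Fin I.n := ⟨i % I.n, Nat.mod_lt _ I.n_pos⟩

theorem eval_root : root.eval I.encode ρ A = I.vertex (ρ 3) := by
  simp [root, vertex]

theorem eval_col : col.eval I.encode ρ A = I.vertex (ρ 4) := by
  simp [col, vertex]

theorem eval_row : row.eval I.encode ρ A = ρ 4 / I.n := by
  simp [row]

theorem eval_good : Exp.good.eval I.encode ρ A = I.good (I.vertex (ρ 3)) := by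
  rw [Exp.good, eval_mul, eval_sub, eval_sign, eval_prod_size]
  have : ∀ a : Fin I.n, (1 - team (.var 7) * (1 - profile (.var 7) root) : Exp).eval I.encode
      (update ρ 7 a) A = if a ∈ I.T → I.φ a (I.vertex (ρ 3)) = true then 1 else 0 := by
    intro a
    rw [eval_sub, eval_mul, eval_sub, I.eval_team (a := a) (by simp),
      I.eval_profile (a := a) (b := I.vertex (ρ 3)) (by simp) (by rw [eval_root]; simp)]
    by_cases h : a ∈ I.T <;> cases I.φ a (I.vertex (ρ 3)) <;> simp [h]
  rw [Finset.prod_congr rfl fun a _ => this a, good]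
  by_cases hk : I.k < 0
  · simp [hk]
  · rw [prod_ite_zero]
    simp [not_lt.1 hk, hk]

/-- The table of the numbers of branching walks that avoid the set with number `y / n` and visit
only individuals who qualify `y % n`: rows are indexed by weights, columns by individuals. -/
def table (y p : ℕ) : ℕ := avoiding I.φ (fun a => I.φ a (I.vertex y)) I.weight
  (subsetOf I.S (y / I.n)) (p / I.n) (I.vertex p)

theorem table_mul_add (y j : ℕ) (v : Fin I.n) : I.table y (j * I.n + v) =
    avoiding I.φ (fun a => I.φ a (I.vertex y)) I.weight (subsetOf I.S (y / I.n)) j v := by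
  rw [table, mul_comm, Nat.mul_add_div I.n_pos, Nat.div_eq_of_lt v.2, Nat.add_zero]
  congr 1
  ext
  simp [vertex, Nat.mod_eq_of_lt v.2]

theorem eval_count (hA : ∀ q < (I.n * (I.budget + 1) + 1) * I.n, A q = I.table (ρ 3) q)
    (hlen : I.n * (I.budget + 1) + 1 ≤ I.encode.length) :
    Exp.count.eval I.encode ρ A = I.count (subsetOf I.S (ρ 3 / I.n)) (I.vertex (ρ 3)) := by
  rw [Exp.count, eval_sum 9 (I.eval_levels ρ A) hlen, count]
  refine sum_congr rfl fun j hj => ?_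
  have hj := mem_range.1 hj
  simp only [eval_arr, eval_add, eval_mul, eval_var, eval_size, update_self, eval_root]
  rw [update_of_ne (by decide), hA, table_mul_add]
  have := (I.vertex (ρ 3)).2
  nlinarith

theorem eval_entry (hA : ∀ q < ρ 4, A q = I.table (ρ 3) q) (hlen : ρ 4 / I.n ≤ I.encode.length) :
    entry.eval I.encode ρ A = I.table (ρ 3) (ρ 4) := by
  have hn := I.n_pos
  rw [table, avoiding_eq, entry, eval_add, eval_sum_size]
  congr 1
  · rw [eval_mul, eval_mul, eval_sub, eval_eq, I.eval_weight (I.eval_col ρ A),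
      I.eval_profile (I.eval_col ρ A) (I.eval_root ρ A), I.eval_excluded ρ A (I.eval_col ρ A),
      eval_row, eval_ofNat]
    by_cases h1 : ρ 4 / I.n = I.weight (I.vertex (ρ 4)) <;>
    by_cases h2 : I.vertex (ρ 4) ∈ subsetOf I.S (ρ 3 / I.n) <;>
    cases I.φ (I.vertex (ρ 4)) (I.vertex (ρ 3)) <;> simp [h1, h2]
  · refine sum_congr rfl fun u _ => ?_
    rw [eval_mul, I.eval_profile (a := I.vertex (ρ 4)) (b := u) (by rw [eval_col]; simp) (by simp),
      eval_sum (m := ρ 4 / I.n - 1) 11 (by simp [eval_row]) (by omega)]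
    congr 1
    refine sum_congr rfl fun i hi => ?_
    have hi := mem_range.1 hi
    simp only [eval_mul, eval_arr, eval_add, eval_sub, eval_var, eval_size, eval_ofNat, eval_col,
      eval_row, update_self]
    simp only [update_of_ne (show (4 : ℕ) ≠ 11 by decide),
      update_of_ne (show (4 : ℕ) ≠ 10 by decide), update_of_ne (show (10 : ℕ) ≠ 11 by decide),
      update_self]
    have h4 := Nat.div_mul_le_self (ρ 4) I.n
    have hu := u.2
    have hv := (I.vertex (ρ 4)).2
    have hle : ∀ l v, l + 1 ≤ ρ 4 / I.n → v < I.n → l * I.n + v < ρ 4 := fun l v hl hv => by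
      have := Nat.mul_le_mul_right I.n hl
      rw [add_mul] at this
      omega
    rw [hA _ (hle _ _ (by omega) hv), hA _ (hle _ _ (by omega) hu), table_mul_add, table_mul_add]

end GCAIInstance

/-! ### The program -/

/-- The table for the current set and the current root, row after row. -/
def fillTable : Program :=
  forLoop 4 (Exp.levels * Exp.size) (write (.var 4) Exp.entry 6) 3

/-- For every set `X` of distinguished individuals and every root, the number of branching walks
that avoid `X` is added to variable `1` or `2` according to the parity of `X`. -/
def addCounts : Program :=
  forLoop 3 (Exp.subsets * Exp.size) (.seq fillTable (.seq
    (assign 1 (.var 1 + Exp.good * (1 - Exp.parity) * Exp.count) 3)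
    (assign 2 (.var 2 + Exp.good * Exp.parity * Exp.count) 3))) 0

/-- The program for group control by adding individuals under the consensus-start-respecting rule:
the answer is `1` if and only if the even count exceeds the odd one. -/
def solver : Program := .seq addCounts (assign 0 (1 - (1 - (.var 1 - .var 2))) 0)

namespace GCAIInstance

variable (I : GCAIInstance)

/-- The contribution of round `y` to the count for the sets of even size. -/
def evenTerm (y : ℕ) : ℕ := I.good (I.vertex y) * (1 - #(subsetOf I.S (y / I.n)) % 2) *
  I.count (subsetOf I.S (y / I.n)) (I.vertex y)

/-- The contribution of round `y` to the count for the sets of odd size. -/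
def oddTerm (y : ℕ) : ℕ := I.good (I.vertex y) * (#(subsetOf I.S (y / I.n)) % 2) *
  I.count (subsetOf I.S (y / I.n)) (I.vertex y)

theorem sum_range_mul_n (P : ℕ) (g : ℕ → Fin I.n → ℕ) :
    ∑ y ∈ range (P * I.n), g (y / I.n) (I.vertex y) = ∑ z ∈ range P, ∑ r, g z r := by
  induction P with
  | zero => simp
  | succ P ih =>
    rw [add_mul, one_mul, sum_range_add, ih, sum_range_succ, sum_range (n := I.n)]
    congr 1
    refine sum_congr rfl fun r _ => ?_
    congr 1
    · rw [mul_comm, Nat.mul_add_div I.n_pos, Nat.div_eq_of_lt r.2, Nat.add_zero]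
    · ext
      simp [vertex, Nat.mod_eq_of_lt r.2]

theorem yes_iff_terms : I.Yes csr ↔
    ∑ y ∈ range (2 ^ #I.S * I.n), I.oddTerm y < ∑ y ∈ range (2 ^ #I.S * I.n), I.evenTerm y := by
  rw [yes_iff_lt, ← sum_range_subsetOf I.S, ← sum_range_subsetOf I.S]
  have h1 := I.sum_range_mul_n (2 ^ #I.S) fun z r =>
    I.good r * (#(subsetOf I.S z) % 2) * I.count (subsetOf I.S z) r
  have h2 := I.sum_range_mul_n (2 ^ #I.S) fun z r =>
    I.good r * (1 - #(subsetOf I.S z) % 2) * I.count (subsetOf I.S z) r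
  rw [← h1, ← h2]
  rfl

/-! ### Size bounds -/

/-- All numbers that occur have at most this length if the input word has length `m`. -/
def sizeBound (m : ℕ) : ℕ := 4 * m ^ 2 + 3 * m + 1

theorem levels_le : I.n * (I.budget + 1) + 1 ≤ I.encode.length := by
  have : I.budget ≤ I.n := min_le_right _ _
  have := Nat.mul_le_mul_left I.n this
  rw [length_encode, mul_add]
  omega

theorem card_le : #I.S ≤ I.encode.length := by
  have := card_le_univ I.S
  rw [Fintype.card_fin] at this
  exact this.trans I.n_le_length

theorem avoiding_le_two_pow (N : Fin I.n → Bool) (X : Finset (Fin I.n)) {j : ℕ}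
    (hj : j < I.n * (I.budget + 1) + 1) (v : Fin I.n) :
    avoiding I.φ N I.weight X j v ≤ 2 ^ (4 * I.encode.length ^ 2) := by
  have hl := I.levels_le
  have hn := I.n_le_length
  set m := I.encode.length
  have hm : m + 1 ≤ 2 ^ m := m.lt_two_pow_self
  have hK : Fintype.card (Fin I.n) * (I.n * (I.budget + 1)) + 1 ≤ 2 ^ (2 * m) := by
    rw [Fintype.card_fin, mul_comm 2 m, pow_mul]
    have h1 : I.n * (I.n * (I.budget + 1)) ≤ m * m := Nat.mul_le_mul hn (by omega)
    nlinarith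
  refine (avoiding_le X hK (by omega) v).trans ?_
  rw [← pow_mul]
  refine Nat.pow_le_pow_right two_pos ?_
  have : 2 * m * (2 * j - 1) ≤ 2 * m * (2 * m) := Nat.mul_le_mul_left _ (by omega)
  nlinarith

theorem table_le (y : ℕ) {p : ℕ} (hp : p < (I.n * (I.budget + 1) + 1) * I.n) :
    I.table y p ≤ 2 ^ (4 * I.encode.length ^ 2) :=
  I.avoiding_le_two_pow _ _ ((Nat.div_lt_iff_lt_mul I.n_pos).2 hp) _

theorem count_le (X : Finset (Fin I.n)) (r : Fin I.n) :
    I.count X r ≤ 2 ^ (4 * I.encode.length ^ 2 + I.encode.length) := by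
  refine (sum_le_card_nsmul _ _ _ fun j hj =>
    I.avoiding_le_two_pow _ X (mem_range.1 hj) r).trans ?_
  rw [card_range, smul_eq_mul, pow_add, mul_comm]
  exact Nat.mul_le_mul_left _ (I.levels_le.trans I.encode.length.lt_two_pow_self.le)

theorem good_le (r : Fin I.n) : I.good r ≤ 1 := by
  unfold good; split_ifs <;> simp

theorem evenTerm_le (y : ℕ) :
    I.evenTerm y ≤ 2 ^ (4 * I.encode.length ^ 2 + I.encode.length) := by
  have h : I.good (I.vertex y) * (1 - #(subsetOf I.S (y / I.n)) % 2) ≤ 1 * 1 :=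
    Nat.mul_le_mul (I.good_le _) (Nat.sub_le _ _)
  simpa [evenTerm] using Nat.mul_le_mul h (I.count_le (subsetOf I.S (y / I.n)) (I.vertex y))

theorem oddTerm_le (y : ℕ) :
    I.oddTerm y ≤ 2 ^ (4 * I.encode.length ^ 2 + I.encode.length) := by
  have h : I.good (I.vertex y) * (#(subsetOf I.S (y / I.n)) % 2) ≤ 1 * 1 :=
    Nat.mul_le_mul (I.good_le _) (by omega)
  simpa [oddTerm] using Nat.mul_le_mul h (I.count_le (subsetOf I.S (y / I.n)) (I.vertex y))

theorem rounds_le : 2 ^ #I.S * I.n ≤ 2 ^ (2 * I.encode.length) := by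
  rw [two_mul, pow_add]
  exact Nat.mul_le_mul (Nat.pow_le_pow_right two_pos I.card_le)
    (I.n_le_length.trans I.encode.length.lt_two_pow_self.le)

theorem size_sum_le {f : ℕ → ℕ}
    (hf : ∀ y, f y ≤ 2 ^ (4 * I.encode.length ^ 2 + I.encode.length)) {Y : ℕ}
    (hY : Y ≤ 2 ^ #I.S * I.n) : (∑ y ∈ range Y, f y).size ≤ sizeBound I.encode.length := by
  rw [Nat.size_le, sizeBound, pow_succ]
  have h1 := (sum_le_card_nsmul (range Y) f _ fun y _ => hf y).trans
    (Nat.mul_le_mul_right _ ((card_range Y).le.trans (hY.trans I.rounds_le)))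
  rw [← pow_add, show 2 * I.encode.length + (4 * I.encode.length ^ 2 + I.encode.length) =
    4 * I.encode.length ^ 2 + 3 * I.encode.length by ring] at h1
  have := Nat.two_pow_pos (4 * I.encode.length ^ 2 + 3 * I.encode.length)
  exact h1.trans_lt (by omega)

theorem size_table_le (y : ℕ) {p : ℕ} (hp : p < (I.n * (I.budget + 1) + 1) * I.n) :
    (I.table y p).size ≤ sizeBound I.encode.length := by
  rw [Nat.size_le, sizeBound]
  refine (I.table_le y hp).trans_lt (Nat.pow_lt_pow_right one_lt_two ?_)
  omega

theorem size_le_of_lt_rounds {y : ℕ} (hy : y < 2 ^ #I.S * I.n) :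
    y.size ≤ sizeBound I.encode.length := by
  rw [Nat.size_le, sizeBound]
  exact (hy.trans_le I.rounds_le).trans_le (Nat.pow_le_pow_right two_pos (by omega))

theorem entries_le : (I.n * (I.budget + 1) + 1) * I.n ≤ I.encode.length * I.encode.length :=
  Nat.mul_le_mul I.levels_le I.n_le_length

theorem size_le_of_lt_entries {p : ℕ} (hp : p < (I.n * (I.budget + 1) + 1) * I.n) :
    p.size ≤ sizeBound I.encode.length := by
  refine (size_le_self p).trans ((hp.le.trans I.entries_le).trans ?_)
  rw [sizeBound]
  nlinarith

/-! ### Correctness and running time -/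

/-- The situation at the beginning of round `Y`. -/
def Inv (Y : ℕ) (ρ A : ℕ → ℕ) : Prop := Bounded (sizeBound I.encode.length) ρ A ∧
  ρ 1 = ∑ y ∈ range Y, I.evenTerm y ∧ ρ 2 = ∑ y ∈ range Y, I.oddTerm y

/-- The situation in round `Y` when `p` entries of the table are filled. -/
def TableInv (Y p : ℕ) (ρ A : ℕ → ℕ) : Prop :=
  I.Inv Y ρ A ∧ ρ 3 = Y ∧ ∀ q < p, A q = I.table Y q

theorem le_sizeBound (m : ℕ) : m ≤ sizeBound m := by unfold sizeBound; omega

theorem spec_fillTable : ∃ q : Polynomial ℕ, ∀ (I : GCAIInstance) (Y : ℕ),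
    Spec I.encode 3 fillTable (fun ρ A => ρ 3 = Y ∧ I.Inv Y ρ A)
      (I.TableInv Y ((I.n * (I.budget + 1) + 1) * I.n))
      (q.eval (sizeBound I.encode.length)) := by
  obtain ⟨q, hq⟩ := spec_forLoop 4 (Exp.levels * Exp.size) (write (.var 4) Exp.entry 6) 3
  obtain ⟨q', hq'⟩ := spec_write (.var 4) Exp.entry 6
  refine ⟨q * (.X * .X * (q' + 1) + 1), fun I Y => ?_⟩
  have hL := le_sizeBound I.encode.length
  have hE := I.entries_le
  have key := hq I.encode (sizeBound I.encode.length) ((I.n * (I.budget + 1) + 1) * I.n)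
    (q'.eval (sizeBound I.encode.length)) (fun ρ A => ρ 3 = Y ∧ I.Inv Y ρ A) (I.TableInv Y) hL
    (fun ρ A ⟨h3, h⟩ => ⟨h.1, by simp, h, h3, by simp⟩)
    (fun p ρ A v hv ⟨⟨hb, h1, h2⟩, h3, hA⟩ =>
      ⟨⟨hb.update 4 (I.size_le_of_lt_entries hv), by simpa using h1, by simpa using h2⟩,
        by simpa using h3, hA⟩)
    (fun p hp => hq' I.encode (sizeBound I.encode.length) _ _ hL
      fun ρ A ⟨h4, ⟨hb, h1, h2⟩, h3, hA⟩ => by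
        refine ⟨hb, ?_⟩
        rw [Exp.eval_var, h4, I.eval_entry ρ A (by rwa [h3, h4]) (by
          rw [h4]
          exact ((Nat.div_lt_iff_lt_mul I.n_pos).2 hp).le.trans I.levels_le), h3, h4]
        refine ⟨⟨⟨hb.1, fun i => ?_⟩, h1, h2⟩, h3, fun r hr => ?_⟩
        · by_cases h : i = p
          · subst h
            simpa using I.size_table_le Y hp
          · simpa [h] using hb.2 i
        · by_cases h : r = p
          · simp [h]
          · simpa [h] using hA r (by omega))
  intro s ρ A hs hP
  obtain ⟨s', ρ', A', h, hr⟩ := key s ρ A hs hP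
  refine ⟨s', ρ', A', h.mono ?_, hr⟩
  simp only [Polynomial.eval_mul, Polynomial.eval_add, Polynomial.eval_X, Polynomial.eval_one]
  have := hE.trans (Nat.mul_le_mul hL hL)
  gcongr

theorem spec_addCounts : ∃ q : Polynomial ℕ, ∀ I : GCAIInstance,
    Spec I.encode 0 addCounts (fun ρ A => ρ = 0 ∧ A = 0) (I.Inv (2 ^ #I.S * I.n))
      (2 ^ #I.S * q.eval (sizeBound I.encode.length)) := by
  obtain ⟨q, hq⟩ := spec_forLoop 3 (Exp.subsets * Exp.size) (.seq fillTable (.seq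
    (assign 1 (.var 1 + Exp.good * (1 - Exp.parity) * Exp.count) 3)
    (assign 2 (.var 2 + Exp.good * Exp.parity * Exp.count) 3))) 0
  obtain ⟨q₀, hq₀⟩ := spec_fillTable
  obtain ⟨q₁, hq₁⟩ := spec_assign 1 (.var 1 + Exp.good * (1 - Exp.parity) * Exp.count) 3
  obtain ⟨q₂, hq₂⟩ := spec_assign 2 (.var 2 + Exp.good * Exp.parity * Exp.count) 3
  refine ⟨q * (.X * (q₀ + (q₁ + q₂) + 1) + 1), fun I => ?_⟩
  have hL := le_sizeBound I.encode.length
  set L := sizeBound I.encode.length with hLdef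
  have key := hq I.encode L (2 ^ #I.S * I.n) (q₀.eval L + (q₁.eval L + q₂.eval L))
    (fun ρ A => ρ = 0 ∧ A = 0) I.Inv hL
    (fun ρ A ⟨hρ, hA⟩ => by
      subst hρ hA
      have hb : Bounded L 0 0 := ⟨by simp, by simp⟩
      exact ⟨hb, by simp [I.eval_subsets], hb, by simp, by simp⟩)
    (fun Y ρ A v hv ⟨hb, h1, h2⟩ =>
      ⟨hb.update 3 (I.size_le_of_lt_rounds hv), by simpa using h1, by simpa using h2⟩)
    (fun Y hY => (hq₀ I Y).seq (.seq
      (Q := fun ρ A => (Bounded L ρ A ∧ ρ 1 = ∑ y ∈ range (Y + 1), I.evenTerm y ∧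
        ρ 2 = ∑ y ∈ range Y, I.oddTerm y) ∧ ρ 3 = Y ∧
        ∀ q < (I.n * (I.budget + 1) + 1) * I.n, A q = I.table Y q)
      (hq₁ I.encode L _ _ hL fun ρ A ⟨⟨hb, h1, h2⟩, h3, hA⟩ => by
        have hv : (.var 1 + Exp.good * (1 - Exp.parity) * Exp.count : Exp).eval I.encode ρ A =
            ∑ y ∈ range (Y + 1), I.evenTerm y := by
          simp only [Exp.eval_add, Exp.eval_mul, Exp.eval_sub, Exp.eval_var, Exp.eval_ofNat]
          rw [I.eval_good, I.eval_parity, I.eval_count ρ A (by rwa [h3]) I.levels_le, h3, h1,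
            sum_range_succ, evenTerm]
        rw [hv]
        exact ⟨hb, ⟨hb.update 1 (I.size_sum_le I.evenTerm_le (by omega)), by simp,
          by simpa using h2⟩, by simpa using h3, hA⟩)
      (hq₂ I.encode L _ _ hL fun ρ A ⟨⟨hb, h1, h2⟩, h3, hA⟩ => by
        have hv : (.var 2 + Exp.good * Exp.parity * Exp.count : Exp).eval I.encode ρ A =
            ∑ y ∈ range (Y + 1), I.oddTerm y := by
          simp only [Exp.eval_add, Exp.eval_mul, Exp.eval_var]
          rw [I.eval_good, I.eval_parity, I.eval_count ρ A (by rwa [h3]) I.levels_le, h3, h2,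
            sum_range_succ, oddTerm]
        rw [hv]
        exact ⟨hb, hb.update 2 (I.size_sum_le I.oddTerm_le (by omega)), by simpa using h1,
          by simp⟩)))
  intro s ρ A hs hP
  obtain ⟨s', ρ', A', h, hr⟩ := key s ρ A hs hP
  refine ⟨s', ρ', A', h.mono ?_, hr⟩
  simp only [Polynomial.eval_mul, Polynomial.eval_add, Polynomial.eval_X, Polynomial.eval_one]
  have hn : I.n ≤ L := I.n_le_length.trans hL
  have h1 : 1 ≤ 2 ^ #I.S := Nat.one_le_two_pow
  calc q.eval L * (2 ^ #I.S * I.n * (q₀.eval L + (q₁.eval L + q₂.eval L) + 1) + 1)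
      ≤ q.eval L * (2 ^ #I.S * L * (q₀.eval L + (q₁.eval L + q₂.eval L) + 1) + 2 ^ #I.S) := by
        gcongr
    _ = _ := by ring

theorem solvableInOStar : (gcai csr).SolvableInOStar (fun ℓ => 2 ^ ℓ) := by
  obtain ⟨q, hq⟩ := spec_addCounts
  obtain ⟨q', hq'⟩ := spec_assign 0 (1 - (1 - (.var 1 - .var 2))) 0
  refine ⟨solver, (q + q').comp (4 * .X ^ 2 + 3 * .X + 1), fun I => ?_⟩
  change GCAIInstance at I
  have hspec := (hq I).seq (hq' I.encode (sizeBound I.encode.length) _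
    (fun ρ _ => ρ 0 = 1 ↔ I.Yes csr) (le_sizeBound _) fun ρ A ⟨hb, h1, h2⟩ => ⟨hb, by
      simp only [Exp.eval_sub, Exp.eval_ofNat, Exp.eval_var, update_self, h1, h2]
      rw [yes_iff_terms]
      omega⟩)
  obtain ⟨s', ρ', A', ⟨t, ht, e⟩, hs', hQ, -⟩ := hspec (fun _ => 0) 0 0
    ⟨fun _ => rfl, fun _ => rfl⟩ ⟨rfl, rfl⟩
  refine ⟨s', t, e, ht.trans ?_, ?_⟩
  · have h1 : 1 ≤ 2 ^ #I.S := Nat.one_le_two_pow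
    have heval : ((q + q').comp (4 * .X ^ 2 + 3 * .X + 1)).eval I.encode.length =
        q.eval (sizeBound I.encode.length) + q'.eval (sizeBound I.encode.length) := by
      simp [Polynomial.eval_comp, sizeBound]
    change _ ≤ 2 ^ #I.S * ((q + q').comp (4 * .X ^ 2 + 3 * .X + 1)).eval I.encode.length
    rw [heval, mul_add]
    exact Nat.add_le_add_left (Nat.le_mul_of_pos_left _ h1) _
  · rw [show s' 0 = ρ' 0 from hs'.1 0]
    exact hQ

end GCAIInstance

theorem computable_two_pow : Computable (fun n : ℕ => 2 ^ n) := by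
  have h : Primrec (fun n : ℕ => (Nat.rec 1 (fun _ r => r + r) n : ℕ)) :=
    Primrec.nat_rec₁ 1 (Primrec.nat_add.comp₂ Primrec₂.right Primrec₂.right)
  refine (h.of_eq fun n => ?_).to_comp
  induction n with
  | zero => rfl
  | succ n ih => rw [pow_succ, mul_two, ← ih]

end GroupControl

theorem mainTheorem1 :
    (GroupControl.gcai GroupControl.csr).IsFPT ∧
      (GroupControl.gcai GroupControl.csr).SolvableInOStar (fun ℓ => 2 ^ ℓ) := by
  exact ⟨⟨_, GroupControl.computable_two_pow, GroupControl.GCAIInstance.solvableInOStar⟩,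
    GroupControl.GCAIInstance.solvableInOStar⟩
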